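/- Let $n\ge 2$ be an integer and $p\in(0,1)$. Put $M_0=[0,1]^2$. Divide the unit square into $n^2$ equal closed sub-squares of side $1/n$, keep each of them independently with probability $p$, and let $M_1$ be the union of the kept ones. Repeat the procedure in each kept square, with all choices independent, and let $M_k$ be the union of the kept squares of level $k$, which have side $n^{-k}$. Let $M=\bigcap_{k\ge 1}M_k\subseteq\mathbb{R}^2$ be the limit set of this process (Mandelbrot's fractal percolation). Let $\dim_H$ denote Hausdorff dimension, with the convention $\dim_H\emptyset=-1$. The topological Hausdorff dimension of a metric space $X$ is $\dim_{tH}\emptyset=-1$ if $X$ is empty, and otherwise $$\dim_{tH}X=\inf\{d : X \text{ has a basis } \mathcal U \text{ such that } \dim_H\partial U\le d-1 \text{ for every } U\in\mathcal U\},$$ where $d=\infty$ is allowed and $\infty-1=\infty$. Then: 1. If $p>1/\sqrt n$, then almost surely $\dim_{tH}M\le 2+2\,\dfrac{\log p}{\log n}$. 2. For every $p\in(0,1)$, almost surely $\dim_{tH}M<\dim_H M$ or $M=\emptyset$. -/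

import Mathlib

open MeasureTheory ProbabilityTheory Set

noncomputable section

namespace FractalPercolation

/-- The Hausdorff dimension of a subset of a metric space, with the convention that the
Hausdorff dimension of the empty set is `-1`. -/
def hausdorffDim {X : Type*} [MetricSpace X] (s : Set X) : EReal :=
  open Classical in if s = ∅ then -1 else ((dimH s : ENNReal) : EReal)

/-- The topological Hausdorff dimension of a metric space `X`: it is `-1` if `X` is empty, and
otherwise the infimum of all `d` such that `X` has a basis consisting of (open) sets whose
boundaries have Hausdorff dimension at most `d - 1` (here `⊤ - 1 = ⊤`). -/
def topHausdorffDim (X : Type*) [MetricSpace X] : EReal :=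
  open Classical in
  if IsEmpty X then -1
  else sInf {d : EReal | ∃ U : Set (Set X), TopologicalSpace.IsTopologicalBasis U ∧
    ∀ u ∈ U, hausdorffDim (frontier u) ≤ d - 1}

/-- The Euclidean plane. -/
abbrev Plane : Type := EuclideanSpace ℝ (Fin 2)

/-- Indices `(i, j)` of the squares of level `k` of the `n`-adic subdivision of the unit
square, `0 ≤ i, j < n ^ k`. -/
abbrev Cell (n k : ℕ) : Type := Fin (n ^ k) × Fin (n ^ k)

/-- The closed square `[i / n ^ k, (i + 1) / n ^ k] × [j / n ^ k, (j + 1) / n ^ k]`. -/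
def Cell.square {n k : ℕ} (c : Cell n k) : Set Plane :=
  {x | x 0 ∈ Icc ((c.1 : ℕ) / (n : ℝ) ^ k) (((c.1 : ℕ) + 1) / (n : ℝ) ^ k) ∧
    x 1 ∈ Icc ((c.2 : ℕ) / (n : ℝ) ^ k) (((c.2 : ℕ) + 1) / (n : ℝ) ^ k)}

/-- The square of level `k` that contains a given square of level `k + 1`. -/
def Cell.parent {n k : ℕ} (c : Cell n (k + 1)) : Cell n k :=
  (⟨(c.1 : ℕ) / n, Nat.div_lt_of_lt_mul (by
      have h := c.1.isLt; have e := pow_succ' n k; omega)⟩,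
   ⟨(c.2 : ℕ) / n, Nat.div_lt_of_lt_mul (by
      have h := c.2.isLt; have e := pow_succ' n k; omega)⟩)

/-- All squares of all levels `k + 1 ≥ 1`. -/
abbrev PosCell (n : ℕ) : Type := Σ k : ℕ, Cell n (k + 1)

/-- `keep c` is the event that the square `c` is kept when its parent is subdivided. The family
of these events drives a fractal percolation process with parameter `p` if the events are
independent and each of them has probability `p`. -/
structure IsPercolation {Ω : Type*} [MeasurableSpace Ω] (μ : Measure Ω) (n : ℕ) (p : ℝ)
    (keep : PosCell n → Set Ω) : Prop where
  measurableSet_keep : ∀ c, MeasurableSet (keep c)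
  indep : iIndepSet keep μ
  prob : ∀ c, μ (keep c) = ENNReal.ofReal p

/-- The square `c` of level `k` belongs to `M_k`: it was kept, and so were all its ancestors. -/
def Survives {Ω : Type*} {n : ℕ} (keep : PosCell n → Set Ω) (ω : Ω) :
    (k : ℕ) → Cell n k → Prop
  | 0, _ => True
  | k + 1, c => Survives keep ω k c.parent ∧ ω ∈ keep ⟨k, c⟩

/-- `M_k`, the union of the surviving squares of level `k`; `M_0` is the unit square. -/
def levelSet {Ω : Type*} {n : ℕ} (keep : PosCell n → Set Ω) (k : ℕ) (ω : Ω) : Set Plane :=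
  ⋃ (c : Cell n k) (_ : Survives keep ω k c), c.square

/-- The limit set `M = ⋂_{k ≥ 1} M_k` of the process. -/
def limitSet {Ω : Type*} {n : ℕ} (keep : PosCell n → Set Ω) (ω : Ω) : Set Plane :=
  ⋂ (k : ℕ) (_ : 1 ≤ k), levelSet keep k ω

end FractalPercolation

end

/-!
The boundary estimate and the lower bound for the Hausdorff dimension are proved separately.

**Upper bound for the topological Hausdorff dimension.** A grid line splits the limit set `M` into
two closed pieces, the points reached by surviving cells on one side and on the other
(`lowerPart`, `upperPart`). Finite intersections of complements in `M` of such pieces form a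
basis of the topology of `M`, and their boundaries consist of points reached from *both* sides
(`exists_basis_frontier_subset`). At level `m` such points are covered by pairs of neighbouring
surviving cells on opposite sides of the line; there are at most `3 n ^ m` candidates and each
pair survives with probability of order `p ^ (2 m)`, since the two cells share no ancestors beyond
the level of the line. Hence by Fatou's lemma the boundaries have dimension at most
`1 + 2 log p / log n` if `n p ^ 2 ≥ 1` (`IsPercolation.ae_dimH_twoSided_le`), and by the first
moment method they are empty if `n p ^ 2 < 1` (`IsPercolation.ae_twoSided_eq_empty`).

**Lower bound for the Hausdorff dimension.** For `s < 2 + log p / log n` consider the minimal cost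
`minCut` of a cutset of the tree of kept cells, a cell of level `k` costing `n ^ (-s k)`. If it is
nonzero, then `dimH M ≥ s`, because an efficient cover of `M` would give a cheap cutset
(`le_dimH_limitSet`). The minimal cut has positive expectation: the Galton–Watson martingale is
bounded in `L²`, and capping it at geometrically growing levels loses only a little mass
(`IsPercolation.one_le_lintegral_capFlow_add`). Finally both the extinction probability and the
probability that the minimal cut vanishes satisfy the recursion given by the generating function
`x ↦ (1 - p + p x) ^ (n ^ 2)`. Strict convexity leaves room for only one value below `1`, so the
minimal cut almost surely vanishes only on extinction
(`IsPercolation.ae_extinct_of_minCut_eq_zero`). To avoid comparing laws of different subtrees, the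
argument is run with the infimum and the supremum of these probabilities over all cells. If
`n ^ 2 p ≤ 1`, the same recursion gives almost sure extinction
(`IsPercolation.ae_extinct_of_le_one`).
-/

namespace FractalPercolation

open Filter Topology ENNReal NNReal

/-! ### Cells, children and descendants -/

/-- The integer coordinates of a cell, indexed by the coordinate of the plane. -/
def Cell.coord {n k : ℕ} (c : Cell n k) (t : Fin 2) : ℕ := if t = 0 then c.1 else c.2

theorem Cell.coord_lt {n k : ℕ} (c : Cell n k) (t : Fin 2) : c.coord t < n ^ k := by
  unfold Cell.coord; split_ifs
  exacts [c.1.isLt, c.2.isLt]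

theorem Cell.ext_coord {n k : ℕ} {c e : Cell n k} (h : ∀ t, c.coord t = e.coord t) : c = e := by
  have h0 := h 0
  have h1 := h 1
  simp only [Cell.coord, if_true, one_ne_zero, if_false] at h0 h1
  exact Prod.ext (Fin.ext h0) (Fin.ext h1)

theorem Cell.coord_parent {n k : ℕ} (c : Cell n (k + 1)) (t : Fin 2) :
    c.parent.coord t = c.coord t / n := by
  unfold Cell.coord Cell.parent; split_ifs <;> rfl

theorem Cell.mem_square {n k : ℕ} (c : Cell n k) (x : Plane) :
    x ∈ c.square ↔ ∀ t, (c.coord t : ℝ) / (n : ℝ) ^ k ≤ x t ∧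
      x t ≤ ((c.coord t : ℝ) + 1) / (n : ℝ) ^ k := by
  simp [Cell.square, Cell.coord, Fin.forall_fin_two]

theorem Cell.isClosed_square {n k : ℕ} (c : Cell n k) : IsClosed c.square := by
  have : c.square = ⋂ t, {x : Plane | (c.coord t : ℝ) / (n : ℝ) ^ k ≤ x t} ∩
      {x : Plane | x t ≤ ((c.coord t : ℝ) + 1) / (n : ℝ) ^ k} := by
    ext x; simp only [Cell.mem_square, mem_iInter, mem_inter_iff, mem_ofPred_eq]
  rw [this]
  exact isClosed_iInter fun t => (isClosed_le (by fun_prop) (by fun_prop)).inter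
    (isClosed_le (by fun_prop) (by fun_prop))

theorem Cell.square_subset_parent {n k : ℕ} (hn : 0 < n) (c : Cell n (k + 1)) :
    c.square ⊆ c.parent.square := by
  intro x hx
  rw [Cell.mem_square] at hx ⊢
  intro t
  obtain ⟨h1, h2⟩ := hx t
  have hn' : (0 : ℝ) < n := by exact_mod_cast hn
  rw [c.coord_parent t]
  have e1 : n * (c.coord t / n) ≤ c.coord t := Nat.mul_div_le _ _
  have e2 : c.coord t + 1 ≤ n * (c.coord t / n + 1) := Nat.lt_mul_div_succ _ hn
  have e1' : (n : ℝ) * ((c.coord t / n : ℕ) : ℝ) ≤ c.coord t := by exact_mod_cast e1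
  have e2' : (c.coord t : ℝ) + 1 ≤ n * (((c.coord t / n : ℕ) : ℝ) + 1) := by exact_mod_cast e2
  have hk : (0 : ℝ) < (n : ℝ) ^ k := by positivity
  rw [div_le_iff₀ (by positivity), pow_succ] at h1
  rw [le_div_iff₀ (by positivity), pow_succ] at h2
  rw [div_le_iff₀ (by positivity), le_div_iff₀ (by positivity)]
  constructor <;> nlinarith

/-- The cells of the next level that are contained in a given cell. -/
def Cell.children {n k : ℕ} (c : Cell n k) : Finset (Cell n (k + 1)) :=
  Finset.univ.filter fun e => e.parent = c

theorem Cell.mem_children {n k : ℕ} {c : Cell n k} {e : Cell n (k + 1)} :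
    e ∈ c.children ↔ e.parent = c := by simp [Cell.children]

theorem Cell.card_children {n k : ℕ} (c : Cell n k) : c.children.card = n ^ 2 := by
  have key : c.children.card = (Finset.range n ×ˢ Finset.range n).card := by
    refine Finset.card_bij (fun e _ => ((e.1 : ℕ) % n, (e.2 : ℕ) % n)) ?_ ?_ ?_
    · intro e _
      rcases Nat.eq_zero_or_pos n with rfl | hn
      · exact absurd e.1.isLt (by simp)
      · simp [Nat.mod_lt _ hn]
    · intro e he e' he' h
      rw [Cell.mem_children] at he he'
      have h' : e.parent = e'.parent := he.trans he'.symm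
      have h1 : (e.1 : ℕ) / n = (e'.1 : ℕ) / n := congrArg (fun c => (c.1 : ℕ)) h'
      have h2 : (e.2 : ℕ) / n = (e'.2 : ℕ) / n := congrArg (fun c => (c.2 : ℕ)) h'
      have h3 := congrArg Prod.fst h
      have h4 := congrArg Prod.snd h
      simp only at h3 h4
      refine Prod.ext (Fin.ext ?_) (Fin.ext ?_)
      · rw [← Nat.div_add_mod (e.1 : ℕ) n, ← Nat.div_add_mod (e'.1 : ℕ) n, h1, h3]
      · rw [← Nat.div_add_mod (e.2 : ℕ) n, ← Nat.div_add_mod (e'.2 : ℕ) n, h2, h4]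
    · rintro ⟨a, b⟩ hab
      simp only [Finset.mem_product, Finset.mem_range] at hab
      have bound : ∀ (i : Fin (n ^ k)) (a : ℕ), a < n → n * (i : ℕ) + a < n ^ (k + 1) := by
        intro i a ha
        have h1 : n * ((i : ℕ) + 1) ≤ n * n ^ k := Nat.mul_le_mul_left _ i.isLt
        rw [pow_succ']; rw [mul_add] at h1; omega
      refine ⟨(⟨n * (c.1 : ℕ) + a, bound c.1 a hab.1⟩, ⟨n * (c.2 : ℕ) + b, bound c.2 b hab.2⟩),
        ?_, ?_⟩
      · have hn : 0 < n := by omega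
        rw [Cell.mem_children]
        refine Prod.ext (Fin.ext ?_) (Fin.ext ?_)
        · simp [Cell.parent, Nat.mul_add_div hn, Nat.div_eq_of_lt hab.1]
        · simp [Cell.parent, Nat.mul_add_div hn, Nat.div_eq_of_lt hab.2]
      · simp [Nat.mod_eq_of_lt hab.1, Nat.mod_eq_of_lt hab.2]
  rw [key]; simp [sq]

/-- `c.Under e`: the cell `e` is `c` itself or one of its descendants, that is, dividing the
coordinates of `e` by the right power of `n` gives the coordinates of `c`. -/
def Cell.Under {n k l : ℕ} (c : Cell n k) (e : Cell n l) : Prop :=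
  k ≤ l ∧ ∀ t, e.coord t / n ^ (l - k) = c.coord t

theorem Cell.under_refl {n k : ℕ} (c : Cell n k) : c.Under c := ⟨le_rfl, by simp⟩

theorem Cell.Under.parent {n k l : ℕ} {c : Cell n (k + 1)} {e : Cell n l} (h : c.Under e) :
    c.parent.Under e := by
  refine ⟨by have := h.1; omega, fun t => ?_⟩
  have hl : l - k = (l - (k + 1)) + 1 := by have := h.1; omega
  rw [c.coord_parent, ← h.2 t, hl, pow_succ, Nat.div_div_eq_div_mul]

theorem Cell.Under.unique {n k l : ℕ} {c c' : Cell n k} {e : Cell n l} (h : c.Under e)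
    (h' : c'.Under e) : c = c' :=
  Cell.ext_coord fun t => (h.2 t).symm.trans (h'.2 t)

/-- The cell `c` together with all its descendants, as a set of cells of positive level. -/
def Cell.below {n k : ℕ} (c : Cell n k) : Set (PosCell n) := {v | c.Under v.2}

/-- The proper descendants of the cell `c`. -/
def Cell.strictBelow {n k : ℕ} (c : Cell n k) : Set (PosCell n) := {v | k < v.1 + 1 ∧ c.Under v.2}

theorem Cell.self_mem_below {n k : ℕ} (c : Cell n (k + 1)) : (⟨k, c⟩ : PosCell n) ∈ c.below :=
  c.under_refl

theorem Cell.strictBelow_subset_below {n k : ℕ} (c : Cell n k) : c.strictBelow ⊆ c.below :=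
  fun _ hv => hv.2

theorem Cell.below_subset_strictBelow_parent {n k : ℕ} (c : Cell n (k + 1)) :
    c.below ⊆ c.parent.strictBelow := fun v hv => ⟨by have := hv.1; omega, Cell.Under.parent hv⟩

theorem Cell.disjoint_below {n k : ℕ} {c c' : Cell n k} (h : c ≠ c') :
    Disjoint c.below c'.below :=
  Set.disjoint_left.2 fun _ hv hv' => h (Cell.Under.unique hv hv')

theorem Cell.disjoint_singleton_strictBelow {n k : ℕ} (c : Cell n (k + 1)) :
    Disjoint {(⟨k, c⟩ : PosCell n)} c.strictBelow := by
  rw [Set.disjoint_singleton_left]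
  exact fun h => lt_irrefl _ h.1

/-! ### Independence of disjoint parts of the tree -/

section Independence

variable {Ω : Type*} {n : ℕ} {keep : PosCell n → Set Ω}

/-- The σ-algebra generated by the events `keep v` for `v` in a set of cells. -/
@[reducible]
def keepAlgebra (keep : PosCell n → Set Ω) (S : Set (PosCell n)) : MeasurableSpace Ω :=
  ⨆ v ∈ S, MeasurableSpace.generateFrom {keep v}

theorem keepAlgebra_mono {S T : Set (PosCell n)} (h : S ⊆ T) :
    keepAlgebra keep S ≤ keepAlgebra keep T :=
  biSup_mono fun _ hv => h hv

theorem measurableSet_keepAlgebra {S : Set (PosCell n)} {v : PosCell n} (hv : v ∈ S) :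
    MeasurableSet[keepAlgebra keep S] (keep v) :=
  (le_biSup (fun v => MeasurableSpace.generateFrom {keep v}) hv) _
    (MeasurableSpace.measurableSet_generateFrom rfl)

variable [mΩ : MeasurableSpace Ω] {μ : Measure Ω} {p : ℝ}

theorem IsPercolation.keepAlgebra_le (hk : IsPercolation μ n p keep) (S : Set (PosCell n)) :
    keepAlgebra keep S ≤ mΩ :=
  iSup₂_le fun v _ => MeasurableSpace.generateFrom_le fun s hs => by
    rw [mem_singleton_iff.1 hs]; exact hk.measurableSet_keep v

theorem IsPercolation.indep_keepAlgebra (hk : IsPercolation μ n p keep) {S T : Set (PosCell n)}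
    (h : Disjoint S T) : Indep (keepAlgebra keep S) (keepAlgebra keep T) μ :=
  indep_iSup_of_disjoint
    (fun v => MeasurableSpace.generateFrom_le fun s hs => by
      rw [mem_singleton_iff.1 hs]; exact hk.measurableSet_keep v) hk.indep h

theorem IsPercolation.measureReal_keep (hk : IsPercolation μ n p keep) (hp : 0 ≤ p)
    (v : PosCell n) : μ.real (keep v) = p := by
  rw [measureReal_def, hk.prob, ENNReal.toReal_ofReal hp]

/-- Events that depend on the parts of the tree below different cells of one level are
independent. -/
theorem IsPercolation.measureReal_biInter_below [IsProbabilityMeasure μ]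
    (hk : IsPercolation μ n p keep) {k : ℕ} (A : Cell n k → Set Ω)
    (hA : ∀ c, MeasurableSet[keepAlgebra keep c.below] (A c)) (S : Finset (Cell n k)) :
    μ.real (⋂ c ∈ S, A c) = ∏ c ∈ S, μ.real (A c) := by
  classical
  induction S using Finset.induction_on with
  | empty => simp
  | insert c S hc ih =>
    rw [Finset.set_biInter_insert, Finset.prod_insert hc, ← ih]
    have hd : Disjoint c.below (⋃ e ∈ S, Cell.below e) := by
      simp only [Set.disjoint_iUnion_right]
      exact fun e he => Cell.disjoint_below fun h => hc (h ▸ he)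
    have hm : MeasurableSet[keepAlgebra keep (⋃ e ∈ S, Cell.below e)] (⋂ e ∈ S, A e) :=
      @MeasurableSet.biInter _ _ (keepAlgebra keep (⋃ e ∈ S, Cell.below e)) _ _
        S.countable_toSet fun e he => keepAlgebra_mono (subset_biUnion_of_mem (u := Cell.below) he)
          _ (hA e)
    have := (Indep_iff _ _ _).1 (hk.indep_keepAlgebra hd) _ _ (hA c) hm
    simp only [measureReal_def, this, ENNReal.toReal_mul]

/-- An event attached to each cell, depending only on its proper descendants, that holds at a cell
exactly when it holds at all kept children, has probabilities satisfying the Galton–Watson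
recursion. -/
theorem IsPercolation.measureReal_eq_prod_children [IsProbabilityMeasure μ]
    (hk : IsPercolation μ n p keep) (hp : 0 ≤ p) (E : ∀ k, Cell n k → Set Ω)
    (hE : ∀ k (c : Cell n k), MeasurableSet[keepAlgebra keep c.strictBelow] (E k c))
    (hrec : ∀ k (c : Cell n k), E k c = ⋂ e ∈ c.children, ((keep ⟨k, e⟩)ᶜ ∪ E (k + 1) e))
    {k : ℕ} (c : Cell n k) :
    μ.real (E k c) = ∏ e ∈ c.children, (1 - p + p * μ.real (E (k + 1) e)) := by
  have hkeep : ∀ e : Cell n (k + 1), MeasurableSet[keepAlgebra keep e.below] (keep ⟨k, e⟩) :=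
    fun e => measurableSet_keepAlgebra e.self_mem_below
  have hE' : ∀ e : Cell n (k + 1), MeasurableSet[keepAlgebra keep e.below] (E (k + 1) e) :=
    fun e => keepAlgebra_mono e.strictBelow_subset_below _ (hE _ e)
  rw [hrec, hk.measureReal_biInter_below (fun e => (keep ⟨k, e⟩)ᶜ ∪ E (k + 1) e)
    (fun e => @MeasurableSet.union _ (keepAlgebra keep e.below) _ _
      (@MeasurableSet.compl _ _ (keepAlgebra keep e.below) (hkeep e)) (hE' e))]
  refine Finset.prod_congr rfl fun e _ => ?_
  have hmk := hk.measurableSet_keep ⟨k, e⟩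
  have hmE := hk.keepAlgebra_le _ _ (hE _ e)
  have h1 : (keep ⟨k, e⟩)ᶜ ∪ E (k + 1) e = (keep ⟨k, e⟩ ∩ (E (k + 1) e)ᶜ)ᶜ := by
    rw [compl_inter, compl_compl]
  have h2 : μ.real (keep ⟨k, e⟩ ∩ (E (k + 1) e)ᶜ) = p * (1 - μ.real (E (k + 1) e)) := by
    have := (Indep_iff _ _ _).1 (hk.indep_keepAlgebra e.disjoint_singleton_strictBelow) _ _
      (measurableSet_keepAlgebra (mem_singleton _))
      (@MeasurableSet.compl _ _ (keepAlgebra keep e.strictBelow) (hE _ e))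
    rw [← probReal_compl_eq_one_sub hmE, ← hk.measureReal_keep hp ⟨k, e⟩]
    simp only [measureReal_def, this, ENNReal.toReal_mul]
  rw [h1, probReal_compl_eq_one_sub (hmk.inter hmE.compl), h2]
  ring

end Independence

/-! ### Capped flows on the percolation tree -/

section CapFlow

variable {Ω : Type*} {n : ℕ} {keep : PosCell n → Set Ω}

/-- The flow that can be sent from the cell `c` through its kept descendants of relative depth at
most `d`, when passing to a child multiplies flow by `w` and the flow through a vertex is capped,
by `C` at `c`, the cap being multiplied by `a` at each generation. With `a = C = 1` and
`w = n ^ (-s)` this is the minimal cost of a cutset of depth at most `d`, a cell of relative depth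
`j` costing `n ^ (-s * j)`. With `C = ⊤` there are no caps, and for `w = 1 / (n ^ 2 * p)` this is
the Galton–Watson martingale. -/
noncomputable def capFlow (keep : PosCell n → Set Ω) (w a : ℝ≥0∞) :
    ℕ → ℝ≥0∞ → ∀ k, Cell n k → Ω → ℝ≥0∞
  | 0, C, _, _, _ => min C 1
  | d + 1, C, k, c, ω => min C (w * ∑ e ∈ c.children,
      (keep ⟨k, e⟩).indicator (capFlow keep w a d (a * C) (k + 1) e) ω)

theorem measurable_capFlow (w a : ℝ≥0∞) (d : ℕ) (C : ℝ≥0∞) (k : ℕ) (c : Cell n k) :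
    Measurable[keepAlgebra keep c.strictBelow] (capFlow keep w a d C k c) := by
  induction d generalizing C k with
  | zero => exact @measurable_const _ _ _ (keepAlgebra keep c.strictBelow) _
  | succ d ih =>
    let _ : MeasurableSpace Ω := keepAlgebra keep c.strictBelow
    refine measurable_const.min (measurable_const.mul (Finset.measurable_sum _ fun e he => ?_))
    have hsub : e.below ⊆ c.strictBelow := by
      rw [← Cell.mem_children.1 he]; exact e.below_subset_strictBelow_parent
    refine Measurable.indicator ?_ ?_
    · exact (ih (a * C) (k + 1) e).mono
        (keepAlgebra_mono (e.strictBelow_subset_below.trans hsub)) le_rfl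
    · exact measurableSet_keepAlgebra (hsub e.self_mem_below)

theorem capFlow_le_cap (w a : ℝ≥0∞) (d : ℕ) (C : ℝ≥0∞) (k : ℕ) (c : Cell n k) (ω : Ω) :
    capFlow keep w a d C k c ω ≤ C := by
  cases d <;> exact min_le_left _ _

theorem capFlow_mono_cap (w a : ℝ≥0∞) (d : ℕ) {C C' : ℝ≥0∞} (h : C ≤ C') (k : ℕ) (c : Cell n k) :
    capFlow keep w a d C k c ≤ capFlow keep w a d C' k c := by
  induction d generalizing C C' k with
  | zero => exact fun ω => min_le_min_right _ h
  | succ d ih =>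
    intro ω
    refine min_le_min h (mul_le_mul_right (Finset.sum_le_sum fun e _ => ?_) _)
    exact indicator_le_indicator (ih (mul_le_mul_right h _) _ e ω)

/-- Rescaling by the caps turns a flow with growing caps into one with all caps equal to `1`. -/
theorem capFlow_le_mul (w a : ℝ≥0∞) (d : ℕ) (C : ℝ≥0∞) (k : ℕ) (c : Cell n k) (ω : Ω) :
    capFlow keep w a d C k c ω ≤ C * capFlow keep (w * a) 1 d 1 k c ω := by
  induction d generalizing C k with
  | zero => simp [capFlow]
  | succ d ih =>
    simp only [capFlow, mul_one]
    rw [mul_min, mul_one]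
    refine min_le_min_left _ ?_
    rw [show C * (w * a * ∑ e ∈ c.children,
      (keep ⟨k, e⟩).indicator (capFlow keep (w * a) 1 d 1 (k + 1) e) ω) =
      w * ((a * C) * ∑ e ∈ c.children,
      (keep ⟨k, e⟩).indicator (capFlow keep (w * a) 1 d 1 (k + 1) e) ω) by ring,
      Finset.mul_sum _ _ (a * C)]
    refine mul_le_mul_right (Finset.sum_le_sum fun e _ => ?_) _
    by_cases h : ω ∈ keep ⟨k, e⟩
    · simpa [h] using ih (a * C) (k + 1) e
    · simp [h]

theorem capFlow_succ_le (w : ℝ≥0∞) (d : ℕ) (k : ℕ) (c : Cell n k) (ω : Ω) :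
    capFlow keep w 1 (d + 1) 1 k c ω ≤ capFlow keep w 1 d 1 k c ω := by
  induction d generalizing k with
  | zero => simp [capFlow]
  | succ d ih =>
    rw [capFlow, capFlow]
    refine min_le_min_left _ (mul_le_mul_right (Finset.sum_le_sum fun e _ => ?_) _)
    rw [mul_one]
    exact indicator_le_indicator (ih _ e)

theorem antitone_capFlow (w : ℝ≥0∞) (k : ℕ) (c : Cell n k) (ω : Ω) :
    Antitone fun d => capFlow keep w 1 d 1 k c ω :=
  antitone_nat_of_succ_le fun d => capFlow_succ_le w d k c ω

theorem capFlow_top_succ (w : ℝ≥0∞) {a : ℝ≥0∞} (ha : a ≠ 0) (d k : ℕ) (c : Cell n k) (ω : Ω) :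
    capFlow keep w a (d + 1) ⊤ k c ω =
      w * ∑ e ∈ c.children, (keep ⟨k, e⟩).indicator (capFlow keep w a d ⊤ (k + 1) e) ω := by
  simp [capFlow, ENNReal.mul_top ha]

section Moments

variable [mΩ : MeasurableSpace Ω] {μ : Measure Ω} {p : ℝ}

theorem IsPercolation.measurable_of_strictBelow (hk : IsPercolation μ n p keep) {k : ℕ}
    {c : Cell n k} {Y : Ω → ℝ≥0∞} (hY : Measurable[keepAlgebra keep c.strictBelow] Y) :
    Measurable Y :=
  hY.mono (hk.keepAlgebra_le _) le_rfl

/-- Whether a cell is kept is independent of what happens strictly below it. -/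
theorem IsPercolation.lintegral_indicator_keep (hk : IsPercolation μ n p keep) {k : ℕ}
    (e : Cell n (k + 1)) {Y : Ω → ℝ≥0∞} (hY : Measurable[keepAlgebra keep e.strictBelow] Y) :
    ∫⁻ ω, (keep ⟨k, e⟩).indicator Y ω ∂μ = ENNReal.ofReal p * ∫⁻ ω, Y ω ∂μ := by
  have h1 : ∀ ω, (keep ⟨k, e⟩).indicator Y ω =
      (keep ⟨k, e⟩).indicator (fun _ => (1 : ℝ≥0∞)) ω * Y ω := by
    intro ω; by_cases h : ω ∈ keep ⟨k, e⟩ <;> simp [h]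
  have h2 : Measurable[keepAlgebra keep {⟨k, e⟩}]
      ((keep ⟨k, e⟩).indicator (fun _ => (1 : ℝ≥0∞))) :=
    measurable_const.indicator (measurableSet_keepAlgebra (mem_singleton _))
  have h3 := lintegral_mul_eq_lintegral_mul_lintegral_of_independent_measurableSpace
    (hk.keepAlgebra_le _) (hk.keepAlgebra_le _)
    (hk.indep_keepAlgebra e.disjoint_singleton_strictBelow) h2 hY
  simp_rw [h1]
  rw [h3, lintegral_indicator (hk.measurableSet_keep _)]
  simp [hk.prob]

theorem IsPercolation.lintegral_sum_children (hk : IsPercolation μ n p keep) {k : ℕ}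
    (c : Cell n k) (Y : Cell n (k + 1) → Ω → ℝ≥0∞)
    (hY : ∀ e, Measurable[keepAlgebra keep e.strictBelow] (Y e)) (w : ℝ≥0∞) :
    ∫⁻ ω, w * ∑ e ∈ c.children, (keep ⟨k, e⟩).indicator (Y e) ω ∂μ =
      w * ∑ e ∈ c.children, ENNReal.ofReal p * ∫⁻ ω, Y e ω ∂μ := by
  have hm : ∀ e, Measurable ((keep ⟨k, e⟩).indicator (Y e)) := fun e =>
    (hk.measurable_of_strictBelow (hY e)).indicator (hk.measurableSet_keep _)
  rw [lintegral_const_mul _ (Finset.measurable_sum _ fun e _ => hm e),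
    lintegral_finsetSum _ fun e _ => hm e]
  simp_rw [fun e => hk.lintegral_indicator_keep e (hY e)]

/-- Different children carry independent flows, so only the diagonal terms contribute to the
variance. -/
theorem IsPercolation.lintegral_sq_sum_children_le (hk : IsPercolation μ n p keep) {k : ℕ}
    (c : Cell n k) (Y : Cell n (k + 1) → Ω → ℝ≥0∞)
    (hY : ∀ e, Measurable[keepAlgebra keep e.strictBelow] (Y e)) (w K : ℝ≥0∞)
    (h1 : ∀ e, ∫⁻ ω, Y e ω ∂μ ≤ 1) (h2 : ∀ e, ∫⁻ ω, Y e ω ^ 2 ∂μ ≤ K) :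
    ∫⁻ ω, (w * ∑ e ∈ c.children, (keep ⟨k, e⟩).indicator (Y e) ω) ^ 2 ∂μ ≤
      w * (w * ((n : ℝ≥0∞) ^ 2 * ENNReal.ofReal p)) * K +
        (w * ((n : ℝ≥0∞) ^ 2 * ENNReal.ofReal p)) ^ 2 := by
  classical
  set P := ENNReal.ofReal p
  have hm : ∀ e, Measurable ((keep ⟨k, e⟩).indicator (Y e)) := fun e =>
    (hk.measurable_of_strictBelow (hY e)).indicator (hk.measurableSet_keep _)
  have hm2 : ∀ e f, Measurable fun ω =>
      (keep ⟨k, e⟩).indicator (Y e) ω * (keep ⟨k, f⟩).indicator (Y f) ω := fun e f =>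
    (hm e).mul (hm f)
  have hterm : ∀ e f : Cell n (k + 1),
      ∫⁻ ω, (keep ⟨k, e⟩).indicator (Y e) ω * (keep ⟨k, f⟩).indicator (Y f) ω ∂μ ≤
        (if e = f then P * K else 0) + P ^ 2 := by
    intro e f
    by_cases hef : e = f
    · subst hef
      refine le_trans ?_ le_self_add
      have : ∀ ω, (keep ⟨k, e⟩).indicator (Y e) ω * (keep ⟨k, e⟩).indicator (Y e) ω =
          (keep ⟨k, e⟩).indicator (fun ω => Y e ω ^ 2) ω := by
        intro ω; by_cases h : ω ∈ keep ⟨k, e⟩ <;> simp [h, sq]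
      simp_rw [this]
      rw [hk.lintegral_indicator_keep e ((hY e).pow_const 2), if_pos trivial]
      exact mul_le_mul_right (h2 e) _
    · refine le_trans ?_ le_add_self
      have hmeas : ∀ e : Cell n (k + 1),
          Measurable[keepAlgebra keep e.below] ((keep ⟨k, e⟩).indicator (Y e)) := fun e =>
        ((hY e).mono (keepAlgebra_mono e.strictBelow_subset_below) le_rfl).indicator
          (measurableSet_keepAlgebra e.self_mem_below)
      rw [lintegral_mul_eq_lintegral_mul_lintegral_of_independent_measurableSpace
        (hk.keepAlgebra_le _) (hk.keepAlgebra_le _)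
        (hk.indep_keepAlgebra (Cell.disjoint_below hef)) (hmeas e) (hmeas f),
        hk.lintegral_indicator_keep e (hY e), hk.lintegral_indicator_keep f (hY f), sq]
      exact mul_le_mul' (mul_le_of_le_one_right' (h1 e)) (mul_le_of_le_one_right' (h1 f))
  have hsq : ∀ ω, (w * ∑ e ∈ c.children, (keep ⟨k, e⟩).indicator (Y e) ω) ^ 2 =
      w ^ 2 * ∑ e ∈ c.children, ∑ f ∈ c.children,
        (keep ⟨k, e⟩).indicator (Y e) ω * (keep ⟨k, f⟩).indicator (Y f) ω := by
    intro ω; rw [mul_pow, sq (Finset.sum _ _), Finset.sum_mul_sum]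
  simp_rw [hsq]
  rw [lintegral_const_mul _ (Finset.measurable_sum _ fun e _ => Finset.measurable_sum _
      fun f _ => hm2 e f),
    lintegral_finsetSum _ fun e _ => Finset.measurable_sum _ fun f _ => hm2 e f]
  simp_rw [fun e => lintegral_finsetSum (μ := μ) c.children fun f _ => hm2 e f]
  calc w ^ 2 * ∑ e ∈ c.children, ∑ f ∈ c.children,
        ∫⁻ ω, (keep ⟨k, e⟩).indicator (Y e) ω * (keep ⟨k, f⟩).indicator (Y f) ω ∂μ
      ≤ w ^ 2 * ∑ e ∈ c.children, ∑ f ∈ c.children, ((if e = f then P * K else 0) + P ^ 2) :=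
        mul_le_mul_right (Finset.sum_le_sum fun e _ => Finset.sum_le_sum fun f _ => hterm e f) _
    _ = w ^ 2 * ∑ e ∈ c.children, (P * K + (n : ℝ≥0∞) ^ 2 * P ^ 2) := by
        congr 1
        refine Finset.sum_congr rfl fun e he => ?_
        simp [Finset.sum_add_distrib, he, Cell.card_children]
    _ = _ := by
        simp only [Finset.sum_const, Cell.card_children, nsmul_eq_mul, Nat.cast_pow]
        ring

variable [IsProbabilityMeasure μ]

theorem IsPercolation.lintegral_capFlow_top (hk : IsPercolation μ n p keep) {w a : ℝ≥0∞}
    (ha : a ≠ 0) (hw : w * ((n : ℝ≥0∞) ^ 2 * ENNReal.ofReal p) = 1) (d k : ℕ) (c : Cell n k) :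
    ∫⁻ ω, capFlow keep w a d ⊤ k c ω ∂μ = 1 := by
  induction d generalizing k with
  | zero => simp [capFlow]
  | succ d ih =>
    simp_rw [capFlow_top_succ w ha]
    rw [hk.lintegral_sum_children c _ fun e => measurable_capFlow w a d ⊤ _ e]
    simp only [ih, mul_one, Finset.sum_const, Cell.card_children, nsmul_eq_mul, Nat.cast_pow, hw]

theorem IsPercolation.lintegral_sq_capFlow_top_le (hk : IsPercolation μ n p keep)
    {w a K : ℝ≥0∞} (ha : a ≠ 0) (hw : w * ((n : ℝ≥0∞) ^ 2 * ENNReal.ofReal p) = 1)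
    (hK : w * K + 1 ≤ K) (d k : ℕ) (c : Cell n k) :
    ∫⁻ ω, capFlow keep w a d ⊤ k c ω ^ 2 ∂μ ≤ K := by
  induction d generalizing k with
  | zero => simpa [capFlow] using le_add_self.trans hK
  | succ d ih =>
    simp_rw [capFlow_top_succ w ha]
    refine (hk.lintegral_sq_sum_children_le c _ (fun e => measurable_capFlow w a d ⊤ _ e) w K
      (fun e => (hk.lintegral_capFlow_top ha hw d _ e).le) fun e => ih _ e).trans ?_
    rwa [hw, mul_one, one_pow]

theorem le_min_add_sq_div {C : ℝ≥0∞} (hC : C ≠ 0) (hC' : C ≠ ⊤) (x : ℝ≥0∞) :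
    x ≤ min C x + x ^ 2 / C := by
  rcases le_total x C with h | h
  · rw [min_eq_right h]; exact le_self_add
  · refine le_trans ?_ le_add_self
    rw [ENNReal.le_div_iff_mul_le (Or.inl hC) (Or.inl hC'), sq]
    exact mul_le_mul_right h _

/-- Capping loses little of the martingale: as the caps grow geometrically, the second moment
bound makes the expected losses of all generations sum to at most `B / C`. -/
theorem IsPercolation.one_le_lintegral_capFlow_add (hk : IsPercolation μ n p keep)
    {w a K B : ℝ≥0∞} (ha : 1 ≤ a) (ha' : a ≠ ⊤)
    (hw : w * ((n : ℝ≥0∞) ^ 2 * ENNReal.ofReal p) = 1)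
    (hK : w * K + 1 ≤ K) (hB : B / a + K ≤ B) (d : ℕ) {C : ℝ≥0∞} (hC : 1 ≤ C) (hC' : C ≠ ⊤)
    (k : ℕ) (c : Cell n k) :
    1 ≤ ∫⁻ ω, capFlow keep w a d C k c ω ∂μ + B / C := by
  have ha0 : a ≠ 0 := (zero_lt_one.trans_le ha).ne'
  induction d generalizing C k with
  | zero => simp [capFlow, hC]
  | succ d ih =>
    have hC0 : C ≠ 0 := (zero_lt_one.trans_le hC).ne'
    set S : Ω → ℝ≥0∞ := fun ω => w * ∑ e ∈ c.children,
      (keep ⟨k, e⟩).indicator (capFlow keep w a d (a * C) (k + 1) e) ω with hS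
    have hSm : Measurable S := measurable_const.mul (Finset.measurable_sum _ fun e _ =>
      (hk.measurable_of_strictBelow (measurable_capFlow w a d _ _ e)).indicator
        (hk.measurableSet_keep _))
    have hmean : 1 ≤ ∫⁻ ω, S ω ∂μ + B / (a * C) := by
      rw [hk.lintegral_sum_children c _ fun e => measurable_capFlow w a d (a * C) _ e]
      have hstep : ∀ e : Cell n (k + 1),
          1 ≤ ∫⁻ ω, capFlow keep w a d (a * C) (k + 1) e ω ∂μ + B / (a * C) := fun e =>
        ih (hC.trans (le_mul_of_one_le_left' ha)) (ENNReal.mul_ne_top ha' hC') _ e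
      calc (1 : ℝ≥0∞) = w * ∑ e ∈ c.children, ENNReal.ofReal p * 1 := by
            simp only [mul_one, Finset.sum_const, Cell.card_children, nsmul_eq_mul, Nat.cast_pow,
              hw]
        _ ≤ w * ∑ e ∈ c.children, ENNReal.ofReal p *
              (∫⁻ ω, capFlow keep w a d (a * C) (k + 1) e ω ∂μ + B / (a * C)) :=
            mul_le_mul_right (Finset.sum_le_sum fun e _ => mul_le_mul_right (hstep e) _) _
        _ = w * ∑ e ∈ c.children, ENNReal.ofReal p *
              ∫⁻ ω, capFlow keep w a d (a * C) (k + 1) e ω ∂μ +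
              w * ((n : ℝ≥0∞) ^ 2 * ENNReal.ofReal p) * (B / (a * C)) := by
            simp only [mul_add, Finset.sum_add_distrib, Finset.sum_const, Cell.card_children,
              nsmul_eq_mul, Nat.cast_pow]
            ring
        _ = _ := by rw [hw, one_mul]
    have hsq : ∫⁻ ω, S ω ^ 2 ∂μ ≤ K := by
      refine le_trans (lintegral_mono fun ω => ?_)
        (hk.lintegral_sq_capFlow_top_le ha0 hw hK (d + 1) k c)
      simp only [capFlow_top_succ w ha0]
      refine pow_le_pow_left' (mul_le_mul_right (Finset.sum_le_sum fun e _ => ?_) _) 2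
      exact indicator_le_indicator (capFlow_mono_cap w a d le_top _ e ω)
    have hloss : ∫⁻ ω, S ω ∂μ ≤ ∫⁻ ω, capFlow keep w a (d + 1) C k c ω ∂μ + K / C := by
      calc ∫⁻ ω, S ω ∂μ ≤ ∫⁻ ω, (min C (S ω) + S ω ^ 2 / C) ∂μ :=
            lintegral_mono fun ω => le_min_add_sq_div hC0 hC' _
        _ = ∫⁻ ω, min C (S ω) ∂μ + (∫⁻ ω, S ω ^ 2 ∂μ) / C := by
            rw [lintegral_add_left (measurable_const.min hSm)]
            simp only [div_eq_mul_inv]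
            rw [lintegral_mul_const _ (hSm.pow_const 2)]
        _ ≤ _ := by
            gcongr
            exact le_rfl
    calc (1 : ℝ≥0∞) ≤ ∫⁻ ω, S ω ∂μ + B / (a * C) := hmean
      _ ≤ ∫⁻ ω, capFlow keep w a (d + 1) C k c ω ∂μ + K / C + B / (a * C) := by gcongr
      _ = ∫⁻ ω, capFlow keep w a (d + 1) C k c ω ∂μ + (B / a + K) / C := by
          rw [ENNReal.add_div, add_assoc, add_comm (K / C)]
          congr 2
          simp only [div_eq_mul_inv]
          rw [ENNReal.mul_inv (Or.inl ha0) (Or.inl ha'), mul_assoc]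
      _ ≤ _ := by gcongr

end Moments

end CapFlow

/-! ### Extinction and vanishing of the minimal cut -/

section Extinction

/-- The Galton–Watson generating function `x ↦ (1 - p + p x) ^ N` is strictly convex and fixes `1`,
so below `1` it cannot be at most the identity at `z` and at least the identity at some `q > z`. -/
theorem eq_of_pow_le_of_le_pow {p z q : ℝ} {N : ℕ} (hN : 2 ≤ N) (hp0 : 0 < p) (hp1 : p < 1)
    (hz0 : 0 ≤ z) (hzq : z ≤ q) (hq1 : q < 1) (hz : (1 - p + p * z) ^ N ≤ z)
    (hq : q ≤ (1 - p + p * q) ^ N) : z = q := by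
  by_contra hne
  have hlt : z < q := lt_of_le_of_ne hzq hne
  have hz1 : 0 < 1 - z := by linarith
  -- `q = l * z + (1 - l) * 1`
  set l : ℝ := (1 - q) / (1 - z) with hl
  have hl0 : 0 < l := div_pos (by linarith) hz1
  have hl1 : l < 1 := by rw [hl, div_lt_one hz1]; linarith
  have hlq : l * (1 - z) = 1 - q := div_mul_cancel₀ _ hz1.ne'
  have hsc := (strictConvexOn_pow hN).2 (x := 1 - p + p * z) (y := 1)
    (by have := mul_nonneg hp0.le hz0; simp only [mem_Ici]; linarith) (by simp)
    (by nlinarith) hl0 (sub_pos.2 hl1) (by ring)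
  simp only [smul_eq_mul, one_pow, mul_one] at hsc
  have e1 : l * (1 - p + p * z) + (1 - l) = 1 - p + p * q := by
    linear_combination (-p) * hlq
  rw [e1] at hsc
  nlinarith [mul_le_mul_of_nonneg_left hz hl0.le]

/-- In the critical and subcritical cases `1` is the only point of `[0, 1]` at which the
Galton–Watson generating function is at most the identity. -/
theorem one_le_of_pow_le {p z : ℝ} {N : ℕ} (hN : 2 ≤ N) (hp0 : 0 < p) (hp1 : p < 1)
    (hz0 : 0 ≤ z) (hNp : N * p ≤ 1) (hz : (1 - p + p * z) ^ N ≤ z) : 1 ≤ z := by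
  by_contra! hlt
  have h := one_add_mul_self_lt_rpow_one_add (s := -(p * (1 - z))) (by nlinarith)
    (by have : 0 < p * (1 - z) := mul_pos hp0 (by linarith)
        linarith) (p := (N : ℝ)) (by exact_mod_cast hN)
  rw [Real.rpow_natCast, show 1 + -(p * (1 - z)) = 1 - p + p * z by ring] at h
  nlinarith [mul_le_mul_of_nonneg_right hNp (sub_nonneg.2 hlt.le)]

variable {Ω : Type*} {n : ℕ} {keep : PosCell n → Set Ω}

/-- The infimum over all depths of the minimal cost of a cutset of the kept tree below `c`, where
each generation multiplies costs by `w`. -/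
noncomputable def minCut (keep : PosCell n → Set Ω) (w : ℝ≥0∞) (k : ℕ) (c : Cell n k) (ω : Ω) :
    ℝ≥0∞ :=
  ⨅ d, capFlow keep w 1 d 1 k c ω

theorem minCut_eq {w : ℝ≥0∞} (hw : w ≠ ⊤) (k : ℕ) (c : Cell n k) (ω : Ω) :
    minCut keep w k c ω =
      min 1 (w * ∑ e ∈ c.children, (keep ⟨k, e⟩).indicator (minCut keep w (k + 1) e) ω) := by
  have h1 : ∀ k (c : Cell n k), Tendsto (fun d => capFlow keep w 1 d 1 k c ω) atTop
      (𝓝 (minCut keep w k c ω)) := fun k c => tendsto_atTop_iInf (antitone_capFlow w k c ω)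
  have h2 := (tendsto_add_atTop_iff_nat 1).2 (h1 k c)
  -- The flows of depth `d + 1` at `c` converge to both sides.
  refine tendsto_nhds_unique h2 ?_
  simp only [capFlow, mul_one]
  refine tendsto_const_nhds.min (ENNReal.Tendsto.const_mul (tendsto_finsetSum _ fun e _ => ?_)
    (Or.inr hw))
  by_cases h : ω ∈ keep ⟨k, e⟩
  · simpa only [indicator_of_mem h] using h1 (k + 1) e
  · simp only [indicator_of_notMem h]; exact tendsto_const_nhds

theorem minCut_le_one (w : ℝ≥0∞) (k : ℕ) (c : Cell n k) (ω : Ω) : minCut keep w k c ω ≤ 1 :=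
  (iInf_le _ 0).trans (capFlow_le_cap _ _ _ _ _ _ _)

theorem minCut_eq_zero_iff {w : ℝ≥0∞} (hw : w ≠ ⊤) (hw0 : w ≠ 0) (k : ℕ) (c : Cell n k) (ω : Ω) :
    minCut keep w k c ω = 0 ↔
      ∀ e ∈ c.children, ω ∈ keep ⟨k, e⟩ → minCut keep w (k + 1) e ω = 0 := by
  rw [minCut_eq hw, ← ENNReal.bot_eq_zero, min_eq_bot]
  simp [hw0, Finset.sum_eq_zero_iff]

theorem exists_capFlow_eq_zero_iff {w : ℝ≥0∞} (hw0 : w ≠ 0) (k : ℕ) (c : Cell n k) (ω : Ω) :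
    (∃ d, capFlow keep w 1 d 1 k c ω = 0) ↔
      ∀ e ∈ c.children, ω ∈ keep ⟨k, e⟩ → ∃ d, capFlow keep w 1 d 1 (k + 1) e ω = 0 := by
  have key : ∀ d, capFlow keep w 1 (d + 1) 1 k c ω = 0 ↔
      ∀ e ∈ c.children, ω ∈ keep ⟨k, e⟩ → capFlow keep w 1 d 1 (k + 1) e ω = 0 := by
    intro d
    rw [capFlow, ← ENNReal.bot_eq_zero, min_eq_bot]
    simp [hw0, Finset.sum_eq_zero_iff]
  constructor
  · rintro ⟨d, hd⟩ e he hke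
    cases d with
    | zero => simp [capFlow] at hd
    | succ d => exact ⟨d, (key d).1 hd e he hke⟩
  · intro h
    have h' : ∀ e : Cell n (k + 1), ∃ d, e ∈ c.children → ω ∈ keep ⟨k, e⟩ →
        capFlow keep w 1 d 1 (k + 1) e ω = 0 := by
      intro e
      by_cases he : e ∈ c.children ∧ ω ∈ keep ⟨k, e⟩
      · obtain ⟨d, hd⟩ := h e he.1 he.2
        exact ⟨d, fun _ _ => hd⟩
      · exact ⟨0, fun h1 h2 => absurd ⟨h1, h2⟩ he⟩
    choose D hD using h'
    refine ⟨Finset.univ.sup D + 1, (key _).2 fun e he hke => ?_⟩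
    exact nonpos_iff_eq_zero.1 ((antitone_capFlow w _ e ω
      (Finset.le_sup (f := D) (Finset.mem_univ e))).trans (hD e he hke).le)

/-- A surviving cell of level `k` with a nonzero cut below it forces a nonzero cut at the root. -/
theorem capFlow_root_ne_zero {w : ℝ≥0∞} (hw0 : w ≠ 0) {ω : Ω} (k : ℕ) (d : ℕ) (e : Cell n k)
    (he : Survives keep ω k e) (h : capFlow keep w 1 d 1 k e ω ≠ 0) (r : Cell n 0) :
    capFlow keep w 1 (d + k) 1 0 r ω ≠ 0 := by
  induction k generalizing d with
  | zero =>
    have : e = r := Cell.ext_coord fun t => by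
      have h1 := e.coord_lt t
      have h2 := r.coord_lt t
      simp only [pow_zero] at h1 h2; omega
    rwa [this] at h
  | succ k ih =>
    rw [show d + (k + 1) = (d + 1) + k by ring]
    refine ih (d + 1) e.parent he.1 ?_
    rw [capFlow, ← pos_iff_ne_zero, lt_min_iff, pos_iff_ne_zero (a := w * _)]
    refine ⟨zero_lt_one, mul_ne_zero hw0 fun h0 => ?_⟩
    have := Finset.sum_eq_zero_iff.1 h0 e (Cell.mem_children.2 rfl)
    rw [indicator_of_mem he.2, mul_one] at this
    exact h this

/-- Extinction of the tree of cells makes the limit set empty. -/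
theorem limitSet_eq_empty {w : ℝ≥0∞} (hw0 : w ≠ 0) {ω : Ω} {r : Cell n 0}
    (h : ∃ d, capFlow keep w 1 d 1 0 r ω = 0) : limitSet keep ω = ∅ := by
  obtain ⟨d, hd⟩ := h
  rw [Set.eq_empty_iff_forall_notMem]
  intro x hx
  simp only [limitSet, levelSet, mem_iInter, mem_iUnion] at hx
  obtain ⟨c, hc, -⟩ := hx (d + 1) (by omega)
  refine capFlow_root_ne_zero hw0 (d + 1) 0 c hc (by simp [capFlow]) r ?_
  exact nonpos_iff_eq_zero.1 ((antitone_capFlow w 0 r ω (by omega : d ≤ 0 + (d + 1))).trans hd.le)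

variable [mΩ : MeasurableSpace Ω] {μ : Measure Ω} {p : ℝ} [IsProbabilityMeasure μ]

theorem IsPercolation.measureReal_minCut_eq_zero (hk : IsPercolation μ n p keep) (hp : 0 ≤ p)
    {w : ℝ≥0∞} (hw : w ≠ ⊤) (hw0 : w ≠ 0) {k : ℕ} (c : Cell n k) :
    μ.real {ω | minCut keep w k c ω = 0} =
      ∏ e ∈ c.children, (1 - p + p * μ.real {ω | minCut keep w (k + 1) e ω = 0}) := by
  refine hk.measureReal_eq_prod_children hp (fun k c => {ω | minCut keep w k c ω = 0})
    (fun k c => ?_) (fun k c => ?_) c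
  · have : Measurable[keepAlgebra keep c.strictBelow] (minCut keep w k c) :=
      Measurable.iInf fun d => measurable_capFlow w 1 d 1 k c
    exact this (measurableSet_singleton 0)
  · ext ω
    simp only [mem_ofPred_eq, minCut_eq_zero_iff hw hw0 k c, mem_iInter, mem_union, mem_compl_iff,
      imp_iff_not_or]

theorem IsPercolation.measureReal_extinct (hk : IsPercolation μ n p keep) (hp : 0 ≤ p)
    {w : ℝ≥0∞} (hw0 : w ≠ 0) {k : ℕ} (c : Cell n k) :
    μ.real {ω | ∃ d, capFlow keep w 1 d 1 k c ω = 0} =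
      ∏ e ∈ c.children, (1 - p + p * μ.real {ω | ∃ d, capFlow keep w 1 d 1 (k + 1) e ω = 0}) := by
  refine hk.measureReal_eq_prod_children hp (fun k c => {ω | ∃ d, capFlow keep w 1 d 1 k c ω = 0})
    (fun k c => ?_) (fun k c => ?_) c
  · rw [ofPred_exists]
    exact @MeasurableSet.iUnion _ _ (keepAlgebra keep c.strictBelow) _ _ fun d =>
      measurable_capFlow w 1 d 1 k c (measurableSet_singleton 0)
  · ext ω
    simp only [mem_ofPred_eq, exists_capFlow_eq_zero_iff hw0 k c, mem_iInter, mem_union,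
      mem_compl_iff, imp_iff_not_or]

/-- The infimum over all cells of the extinction probabilities is a point at which the generating
function is at most the identity. -/
theorem IsPercolation.pow_iInf_extinct_le (hk : IsPercolation μ n p keep)
    (hp0 : 0 ≤ p) (hp1 : p ≤ 1) {w : ℝ≥0∞} (hw0 : w ≠ 0) {z : ℝ}
    (hz : z = ⨅ v : Σ k, Cell n k, μ.real {ω | ∃ d, capFlow keep w 1 d 1 v.1 v.2 ω = 0}) :
    (1 - p + p * z) ^ (n ^ 2) ≤ z := by
  have : Nonempty (Σ k, Cell n k) := ⟨⟨0, ⟨⟨0, by simp⟩, ⟨0, by simp⟩⟩⟩⟩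
  have hz0 : 0 ≤ z := hz ▸ Real.iInf_nonneg fun v => measureReal_nonneg
  conv_rhs => rw [hz]
  refine le_ciInf fun ⟨k, c⟩ => ?_
  dsimp only
  rw [hk.measureReal_extinct hp0 hw0 c, ← c.card_children, ← Finset.prod_const]
  refine Finset.prod_le_prod (fun e _ => by have := mul_nonneg hp0 hz0; linarith) fun e _ => ?_
  have hle : z ≤ μ.real {ω | ∃ d, capFlow keep w 1 d 1 (k + 1) e ω = 0} := by
    rw [hz]
    exact ciInf_le (f := fun v : Σ k, Cell n k =>
      μ.real {ω | ∃ d, capFlow keep w 1 d 1 v.1 v.2 ω = 0})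
      ⟨0, by rintro _ ⟨v, rfl⟩; exact measureReal_nonneg⟩ ⟨k + 1, e⟩
  have := mul_le_mul_of_nonneg_left hle hp0
  linarith

theorem IsPercolation.ae_extinct_of_le_one (hk : IsPercolation μ n p keep) (hn : 2 ≤ n)
    (hp0 : 0 < p) (hp1 : p < 1) (hnp : (n : ℝ) ^ 2 * p ≤ 1) (r : Cell n 0) :
    ∀ᵐ ω ∂μ, ∃ d, capFlow keep 1 1 d 1 0 r ω = 0 := by
  set z := ⨅ v : Σ k, Cell n k, μ.real {ω | ∃ d, capFlow keep 1 1 d 1 v.1 v.2 ω = 0} with hz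
  have hz0 : 0 ≤ z := Real.iInf_nonneg fun v => measureReal_nonneg
  have h1 : 1 ≤ z := one_le_of_pow_le (N := n ^ 2) (by nlinarith) hp0 hp1 hz0
    (by push_cast; exact hnp)
    (hk.pow_iInf_extinct_le hp0.le hp1.le one_ne_zero hz)
  have h2 : z ≤ μ.real {ω | ∃ d, capFlow keep 1 1 d 1 0 r ω = 0} :=
    ciInf_le (f := fun v : Σ k, Cell n k =>
      μ.real {ω | ∃ d, capFlow keep 1 1 d 1 v.1 v.2 ω = 0})
      ⟨0, by rintro _ ⟨v, rfl⟩; exact measureReal_nonneg⟩ ⟨0, r⟩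
  have hm : MeasurableSet {ω | ∃ d, capFlow keep 1 1 d 1 0 r ω = 0} := by
    rw [ofPred_exists]
    exact MeasurableSet.iUnion fun d =>
      hk.measurable_of_strictBelow (measurable_capFlow 1 1 d 1 0 r) (measurableSet_singleton 0)
  have h3 : μ.real {ω | ∃ d, capFlow keep 1 1 d 1 0 r ω = 0} = 1 :=
    le_antisymm measureReal_le_one (h1.trans h2)
  rw [measureReal_def, ENNReal.toReal_eq_one_iff] at h3
  exact (prob_compl_eq_zero_iff hm).2 h3

theorem IsPercolation.measureReal_minCut_eq_zero_le (hk : IsPercolation μ n p keep) {w : ℝ≥0∞}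
    {ε : ℝ} (hε : ∀ d k (c : Cell n k), ENNReal.ofReal ε ≤ ∫⁻ ω, capFlow keep w 1 d 1 k c ω ∂μ)
    (k : ℕ) (c : Cell n k) : μ.real {ω | minCut keep w k c ω = 0} ≤ 1 - ε := by
  have hmeas : ∀ d, Measurable (capFlow keep w 1 d 1 k c) := fun d =>
    hk.measurable_of_strictBelow (measurable_capFlow w 1 d 1 k c)
  have hm : MeasurableSet {ω | minCut keep w k c ω = 0} :=
    (Measurable.iInf hmeas : Measurable (minCut keep w k c)) (measurableSet_singleton 0)
  have h1 : ENNReal.ofReal ε ≤ ∫⁻ ω, minCut keep w k c ω ∂μ := by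
    unfold minCut
    rw [lintegral_iInf hmeas (fun i j hij ω => antitone_capFlow w k c ω hij)]
    · exact le_iInf fun d => hε d k c
    · simp [capFlow]
  have h2 : ∫⁻ ω, minCut keep w k c ω ∂μ ≤ μ {ω | minCut keep w k c ω = 0}ᶜ := by
    rw [← lintegral_indicator_one hm.compl]
    refine lintegral_mono fun ω => ?_
    by_cases h : minCut keep w k c ω = 0
    · simp [h]
    · simpa [indicator, h] using minCut_le_one w k c ω
  have h3 : ε ≤ μ.real {ω | minCut keep w k c ω = 0}ᶜ := by
    rw [measureReal_def, ← ENNReal.ofReal_le_iff_le_toReal (measure_ne_top _ _)]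
    exact h1.trans h2
  rw [probReal_compl_eq_one_sub hm] at h3
  linarith

/-- If the minimal cut has positive expectation, uniformly in the cell and the depth, then almost
surely it vanishes only on extinction. -/
theorem IsPercolation.ae_extinct_of_minCut_eq_zero (hk : IsPercolation μ n p keep) (hn : 2 ≤ n)
    (hp0 : 0 < p) (hp1 : p < 1) {w : ℝ≥0∞} (hw : w ≠ ⊤) (hw0 : w ≠ 0) {ε : ℝ} (hε0 : 0 < ε)
    (hε : ∀ d k (c : Cell n k), ENNReal.ofReal ε ≤ ∫⁻ ω, capFlow keep w 1 d 1 k c ω ∂μ)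
    (r : Cell n 0) :
    ∀ᵐ ω ∂μ, minCut keep w 0 r ω = 0 → ∃ d, capFlow keep w 1 d 1 0 r ω = 0 := by
  set Z : (Σ k, Cell n k) → Set Ω := fun v => {ω | ∃ d, capFlow keep w 1 d 1 v.1 v.2 ω = 0} with hZ
  set Q : (Σ k, Cell n k) → Set Ω := fun v => {ω | minCut keep w v.1 v.2 ω = 0} with hQ
  have : Nonempty (Σ k, Cell n k) := ⟨⟨0, r⟩⟩
  have hZQ : ∀ v, Z v ⊆ Q v := fun v ω ⟨d, hd⟩ => nonpos_iff_eq_zero.1 ((iInf_le _ d).trans hd.le)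
  have hbZ : BddBelow (range fun v => μ.real (Z v)) :=
    ⟨0, by rintro _ ⟨v, rfl⟩; exact measureReal_nonneg⟩
  have hbQ : BddAbove (range fun v => μ.real (Q v)) :=
    ⟨1, by rintro _ ⟨v, rfl⟩; exact measureReal_le_one⟩
  set z := ⨅ v, μ.real (Z v) with hz
  set q := ⨆ v, μ.real (Q v) with hq
  have hz0 : 0 ≤ z := Real.iInf_nonneg fun v => measureReal_nonneg
  have hzr : z ≤ μ.real (Z ⟨0, r⟩) := ciInf_le hbZ _
  have hZQr : μ.real (Z ⟨0, r⟩) ≤ μ.real (Q ⟨0, r⟩) := measureReal_mono (hZQ _)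
  have hqr : μ.real (Q ⟨0, r⟩) ≤ q := le_ciSup hbQ _
  have hq1 : q < 1 := lt_of_le_of_lt
    (ciSup_le fun v => hk.measureReal_minCut_eq_zero_le hε v.1 v.2) (by linarith)
  have hqle : q ≤ (1 - p + p * q) ^ (n ^ 2) := by
    conv_lhs => rw [hq]
    refine ciSup_le fun ⟨k, c⟩ => ?_
    simp only [hQ]
    rw [hk.measureReal_minCut_eq_zero hp0.le hw hw0 c, ← c.card_children, ← Finset.prod_const]
    refine Finset.prod_le_prod (fun e _ => ?_) fun e _ => ?_
    · have := mul_nonneg hp0.le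
        (measureReal_nonneg (μ := μ) (s := {ω | minCut keep w (k + 1) e ω = 0}))
      linarith
    · have hle : μ.real {ω | minCut keep w (k + 1) e ω = 0} ≤ q := le_ciSup hbQ ⟨k + 1, e⟩
      have := mul_le_mul_of_nonneg_left hle hp0.le
      linarith
  have hzq : z = q := eq_of_pow_le_of_le_pow (N := n ^ 2) (by nlinarith) hp0 hp1 hz0
    (hzr.trans (hZQr.trans hqr)) hq1
    (hk.pow_iInf_extinct_le hp0.le hp1.le hw0 hz) hqle
  have hmZ : MeasurableSet (Z ⟨0, r⟩) := by
    simp only [hZ]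
    rw [ofPred_exists]
    exact MeasurableSet.iUnion fun d =>
      hk.measurable_of_strictBelow (measurable_capFlow w 1 d 1 0 r) (measurableSet_singleton 0)
  have hdiff : μ.real (Q ⟨0, r⟩ \ Z ⟨0, r⟩) = 0 := by
    rw [measureReal_sdiff (hZQ _) hmZ]; linarith
  rw [measureReal_eq_zero_iff] at hdiff
  rw [ae_iff]
  refine measure_mono_null (fun ω hω => ?_) hdiff
  simp only [mem_ofPred_eq, Classical.not_imp] at hω
  exact hω

end Extinction

/-! ### Positive expectation of the minimal cut -/

section Positivity

variable {Ω : Type*} [mΩ : MeasurableSpace Ω] {μ : Measure Ω} [IsProbabilityMeasure μ] {n : ℕ}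
  {p : ℝ} {keep : PosCell n → Set Ω}

/-- Below the dimension of the limit set, that is when the mean offspring `n ^ 2 * p` exceeds
`n ^ s`, the minimal cuts have expectations bounded away from zero. -/
theorem IsPercolation.exists_le_lintegral_capFlow (hk : IsPercolation μ n p keep) (hn : 2 ≤ n)
    {s : ℝ} (hs : 0 < s) (hsp : (n : ℝ) ^ s < n ^ 2 * p) :
    ∃ ε : ℝ, 0 < ε ∧ ∀ d k (c : Cell n k),
      ENNReal.ofReal ε ≤ ∫⁻ ω, capFlow keep (ENNReal.ofReal ((n : ℝ) ^ (-s))) 1 d 1 k c ω ∂μ := by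
  have hn0 : (0 : ℝ) < n := by exact_mod_cast (by omega : 0 < n)
  have hns1 : 1 < (n : ℝ) ^ s := Real.one_lt_rpow (by exact_mod_cast (by omega : 1 < n)) hs
  set m : ℝ := n ^ 2 * p with hm
  have hm1 : 1 < m := hns1.trans hsp
  have hm0 : 0 < m := by linarith
  have hp0 : 0 < p := by
    by_contra! h
    have : m ≤ 0 := mul_nonpos_of_nonneg_of_nonpos (by positivity) h
    linarith
  -- `a` is the growth rate of the caps for which the capped martingale is comparable to the cut.
  set a : ℝ := m * (n : ℝ) ^ (-s) with ha
  have ha1 : 1 < a := by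
    rw [ha, Real.rpow_neg hn0.le, ← div_eq_mul_inv, one_lt_div (by linarith)]; exact hsp
  have ha0 : 0 < a := by linarith
  -- `K` solves `K / m + 1 = K` and bounds the second moments; `B` solves `B / a + K = B` and
  -- bounds the accumulated losses; `C` is chosen so that at most half of the mass is lost.
  set K : ℝ := m / (m - 1) with hK
  have hm1' : m - 1 ≠ 0 := by linarith
  have ha1' : a - 1 ≠ 0 := by linarith
  have hK0 : 0 ≤ K := div_nonneg hm0.le (by linarith)
  set B : ℝ := K * a / (a - 1) with hB
  have hB0 : 0 ≤ B := div_nonneg (mul_nonneg hK0 ha0.le) (by linarith)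
  set C : ℝ := 2 * B + 1 with hC
  have hC0 : 0 < C := by linarith
  have hw : ENNReal.ofReal (1 / m) * ((n : ℝ≥0∞) ^ 2 * ENNReal.ofReal p) = 1 := by
    rw [← ENNReal.ofReal_natCast n, ← ENNReal.ofReal_pow hn0.le,
      ← ENNReal.ofReal_mul (by positivity), ← ENNReal.ofReal_mul (by positivity), ← hm,
      one_div, inv_mul_cancel₀ hm0.ne', ENNReal.ofReal_one]
  have hK' : ENNReal.ofReal (1 / m) * ENNReal.ofReal K + 1 ≤ ENNReal.ofReal K := by
    rw [← ENNReal.ofReal_mul (by positivity), ← ENNReal.ofReal_one,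
      ← ENNReal.ofReal_add (by positivity) zero_le_one]
    refine ENNReal.ofReal_le_ofReal (le_of_eq ?_)
    rw [hK]; field_simp; ring
  have hB' : ENNReal.ofReal B / ENNReal.ofReal a + ENNReal.ofReal K ≤ ENNReal.ofReal B := by
    rw [← ENNReal.ofReal_div_of_pos ha0, ← ENNReal.ofReal_add (by positivity) hK0]
    refine ENNReal.ofReal_le_ofReal (le_of_eq ?_)
    rw [hB]; field_simp; ring
  have hwa : ENNReal.ofReal (1 / m) * ENNReal.ofReal a = ENNReal.ofReal ((n : ℝ) ^ (-s)) := by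
    rw [← ENNReal.ofReal_mul (by positivity)]
    congr 1
    rw [ha]; field_simp
  refine ⟨1 / (2 * C), by positivity, fun d k c => ?_⟩
  have h1 := hk.one_le_lintegral_capFlow_add (w := ENNReal.ofReal (1 / m)) (a := ENNReal.ofReal a)
    (by rw [← ENNReal.ofReal_one]; exact ENNReal.ofReal_le_ofReal ha1.le) ENNReal.ofReal_ne_top
    hw hK' hB' d (C := ENNReal.ofReal C)
    (by rw [← ENNReal.ofReal_one]; exact ENNReal.ofReal_le_ofReal (by linarith))
    ENNReal.ofReal_ne_top k c
  have h2 : ∫⁻ ω, capFlow keep (ENNReal.ofReal (1 / m)) (ENNReal.ofReal a) d (ENNReal.ofReal C) k c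
      ω ∂μ ≤ ENNReal.ofReal C *
        ∫⁻ ω, capFlow keep (ENNReal.ofReal ((n : ℝ) ^ (-s))) 1 d 1 k c ω ∂μ := by
    rw [← lintegral_const_mul _ (hk.measurable_of_strictBelow (measurable_capFlow _ 1 d 1 k c)),
      ← hwa]
    exact lintegral_mono fun ω => capFlow_le_mul _ _ d _ k c ω
  have h3 : ENNReal.ofReal B / ENNReal.ofReal C ≤ ENNReal.ofReal (1 / 2) := by
    rw [← ENNReal.ofReal_div_of_pos hC0]
    refine ENNReal.ofReal_le_ofReal ?_
    rw [div_le_iff₀ hC0]; linarith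
  set I := ∫⁻ ω, capFlow keep (ENNReal.ofReal ((n : ℝ) ^ (-s))) 1 d 1 k c ω ∂μ
  have h4 : ENNReal.ofReal (1 / 2) + ENNReal.ofReal (1 / 2) ≤
      ENNReal.ofReal C * I + ENNReal.ofReal (1 / 2) := by
    rw [← ENNReal.ofReal_add (by norm_num) (by norm_num)]
    norm_num only [ENNReal.ofReal_one]
    exact h1.trans (by simpa using add_le_add h2 h3)
  have h5 := (ENNReal.add_le_add_iff_right ENNReal.ofReal_ne_top).1 h4
  have h6 : ENNReal.ofReal (1 / (2 * C)) = ENNReal.ofReal (1 / 2) / ENNReal.ofReal C := by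
    rw [← ENNReal.ofReal_div_of_pos hC0, div_div]
  rw [h6]
  exact ENNReal.div_le_of_le_mul' h5

end Positivity

/-! ### Lower bound for the Hausdorff dimension -/

section LowerBound

variable {Ω : Type*} {n : ℕ} {keep : PosCell n → Set Ω}

theorem Cell.square_nonempty {n k : ℕ} (c : Cell n k) (hn : 0 < n) : c.square.Nonempty := by
  refine ⟨WithLp.toLp 2 fun t => (c.coord t : ℝ) / (n : ℝ) ^ k, ?_⟩
  rw [Cell.mem_square]
  intro t
  have : (0 : ℝ) < (n : ℝ) ^ k := by positivity
  exact ⟨le_rfl, div_le_div_of_nonneg_right (by simp) this.le⟩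

theorem Cell.isCompact_square {n k : ℕ} (c : Cell n k) : IsCompact c.square := by
  refine Metric.isCompact_of_isClosed_isBounded c.isClosed_square ?_
  have hsub : c.square ⊆ (EuclideanSpace.equiv (Fin 2) ℝ).toHomeomorph ⁻¹'
      (Set.Icc (fun t => (c.coord t : ℝ) / (n : ℝ) ^ k)
        (fun t => ((c.coord t : ℝ) + 1) / (n : ℝ) ^ k)) := by
    intro x hx
    rw [Cell.mem_square] at hx
    exact ⟨fun t => (hx t).1, fun t => (hx t).2⟩
  exact ((EuclideanSpace.equiv (Fin 2) ℝ).toHomeomorph.isCompact_preimage.2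
    isCompact_Icc).isBounded.subset hsub

theorem exists_child_of_lt_minCut {w : ℝ≥0∞} (hw : w ≠ ⊤) {ω : Ω} (G : ∀ k, Cell n k → ℝ≥0∞)
    (hG : ∀ k (c : Cell n k), ∑ e ∈ c.children, G (k + 1) e ≤ G k c) {k : ℕ} (c : Cell n k)
    (h : G k c < w ^ k * minCut keep w k c ω) :
    ∃ e : Cell n (k + 1), e.parent = c ∧ ω ∈ keep ⟨k, e⟩ ∧
      G (k + 1) e < w ^ (k + 1) * minCut keep w (k + 1) e ω := by
  have h1 : ∑ e ∈ c.children, G (k + 1) e <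
      ∑ e ∈ c.children, w ^ (k + 1) * (keep ⟨k, e⟩).indicator (minCut keep w (k + 1) e) ω := by
    rw [← Finset.mul_sum, pow_succ, mul_assoc]
    refine ((hG k c).trans_lt h).trans_le (mul_le_mul_right ?_ _)
    rw [minCut_eq hw]
    exact min_le_right _ _
  obtain ⟨e, he, hlt⟩ := Finset.exists_lt_of_sum_lt h1
  by_cases hke : ω ∈ keep ⟨k, e⟩
  · rw [indicator_of_mem hke] at hlt
    exact ⟨e, Cell.mem_children.1 he, hke, hlt⟩
  · rw [indicator_of_notMem hke, mul_zero] at hlt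
    exact absurd hlt _root_.not_lt_zero

/-- A superadditive cost that is smaller than the minimal cut at the root is escaped along some
branch of the tree, and the branch converges to a point of the limit set. -/
theorem exists_mem_limitSet_of_lt_minCut (hn : 0 < n) {w : ℝ≥0∞} (hw : w ≠ ⊤) {ω : Ω}
    (G : ∀ k, Cell n k → ℝ≥0∞)
    (hG : ∀ k (c : Cell n k), ∑ e ∈ c.children, G (k + 1) e ≤ G k c) (r : Cell n 0)
    (h : G 0 r < minCut keep w 0 r ω) :
    ∃ x ∈ limitSet keep ω, ∀ k, ∃ c : Cell n k, x ∈ c.square ∧ G k c < w ^ k := by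
  let P : ∀ k, Cell n k → Prop := fun k c =>
    Survives keep ω k c ∧ G k c < w ^ k * minCut keep w k c ω
  have step : ∀ k (c : {c : Cell n k // P k c}), ∃ e : {e : Cell n (k + 1) // P (k + 1) e},
      e.1.parent = c.1 := by
    rintro k ⟨c, hc, hlt⟩
    obtain ⟨e, rfl, hke, he⟩ := exists_child_of_lt_minCut hw G hG c hlt
    exact ⟨⟨e, ⟨hc, hke⟩, he⟩, rfl⟩
  choose next hnext using step
  let path : ∀ k, {c : Cell n k // P k c} := fun k =>
    Nat.rec ⟨r, trivial, by simpa using h⟩ (fun k c => next k c) k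
  have hpath : ∀ k, (path (k + 1)).1.parent = (path k).1 := fun k => hnext k (path k)
  obtain ⟨x, hx⟩ := IsCompact.nonempty_iInter_of_sequence_nonempty_isCompact_isClosed
    (fun k => (path k).1.square)
    (fun k => by
      have := (path (k + 1)).1.square_subset_parent hn
      rwa [hpath k] at this)
    (fun k => (path k).1.square_nonempty hn) (path 0).1.isCompact_square
    (fun k => (path k).1.isClosed_square)
  rw [mem_iInter] at hx
  refine ⟨x, ?_, fun k => ⟨(path k).1, hx k, (path k).2.2.trans_le
    (mul_le_of_le_one_right' (minCut_le_one _ _ _ _))⟩⟩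
  simp only [limitSet, levelSet, mem_iInter, mem_iUnion]
  exact fun k _ => ⟨(path k).1, (path k).2.1, hx k⟩

open Classical in
/-- A set of diameter at most the side length meets at most `16` cells of a given level. -/
theorem card_filter_meets_le (hn : 0 < n) {l : ℕ} {T : Set Plane}
    (hT : ∀ x ∈ T, ∀ y ∈ T, dist x y ≤ 1 / (n : ℝ) ^ l) :
    (Finset.univ.filter fun v : Cell n l => (T ∩ v.square).Nonempty).card ≤ 16 := by
  rcases T.eq_empty_or_nonempty with rfl | ⟨x, hx⟩
  · simp
  have hnl : (0 : ℝ) < (n : ℝ) ^ l := by positivity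
  set J : Fin 2 → Finset ℤ := fun t =>
    Finset.Icc (⌊x t * (n : ℝ) ^ l⌋ - 2) (⌊x t * (n : ℝ) ^ l⌋ + 1) with hJ
  have hcard : ∀ t, (J t).card = 4 := by
    intro t; simp only [hJ, Int.card_Icc]; omega
  have hle : (Finset.univ.filter fun v : Cell n l => (T ∩ v.square).Nonempty).card ≤
      (J 0 ×ˢ J 1).card := by
    refine Finset.card_le_card_of_injOn (fun v => ((v.coord 0 : ℤ), (v.coord 1 : ℤ))) ?_ ?_
    · intro v hv
      simp only [Finset.coe_filter, Finset.mem_univ, true_and, mem_ofPred_eq] at hv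
      obtain ⟨y, hyT, hyv⟩ := hv
      have key : ∀ t, (v.coord t : ℤ) ∈ J t := by
        intro t
        obtain ⟨h1, h2⟩ := (Cell.mem_square v y).1 hyv t
        have h3 : |x t - y t| ≤ 1 / (n : ℝ) ^ l := by
          refine le_trans ?_ (hT x hx y hyT)
          rw [← Real.dist_eq]
          exact PiLp.dist_apply_le (p := 2) x y t
        rw [abs_le] at h3
        rw [div_le_iff₀ hnl] at h1
        rw [le_div_iff₀ hnl] at h2
        have h4 : (x t - y t) * (n : ℝ) ^ l ≤ 1 := by
          have := mul_le_mul_of_nonneg_right h3.2 hnl.le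
          rwa [div_mul_cancel₀ _ hnl.ne'] at this
        have h5 : -1 ≤ (x t - y t) * (n : ℝ) ^ l := by
          have := mul_le_mul_of_nonneg_right h3.1 hnl.le
          rwa [neg_mul, div_mul_cancel₀ _ hnl.ne'] at this
        have h6 := Int.floor_le (x t * (n : ℝ) ^ l)
        have h7 := Int.lt_floor_add_one (x t * (n : ℝ) ^ l)
        simp only [hJ, Finset.mem_Icc]
        constructor
        · rw [← Int.cast_le (R := ℝ)]; push_cast; linarith
        · refine Int.lt_add_one_iff.1 ?_
          rw [← Int.cast_lt (R := ℝ)]; push_cast; linarith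
      simp [key]
    · intro v _ v' _ hvv
      simp only [Prod.mk.injEq, Nat.cast_inj] at hvv
      exact Cell.ext_coord fun t => by fin_cases t <;> simp [hvv]
  refine hle.trans ?_
  rw [Finset.card_product, hcard, hcard]

/-- A level whose side length is comparable to a given diameter. -/
theorem exists_level (hn : 2 ≤ n) {s D e : ℝ} (hs : 0 < s) (hD0 : 0 ≤ D) (hD1 : D ≤ 1)
    (he : 0 < e) :
    ∃ l : ℕ, D ≤ 1 / (n : ℝ) ^ l ∧ ((n : ℝ) ^ (-s)) ^ l ≤ (n : ℝ) ^ s * (D ^ s + e) := by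
  have hn0 : (0 : ℝ) < n := by exact_mod_cast (by omega : 0 < n)
  have hn1 : (1 : ℝ) < n := by exact_mod_cast (by omega : 1 < n)
  have hDs : 0 ≤ D ^ s := Real.rpow_nonneg hD0 s
  set δ : ℝ := min ((D ^ s + e) ^ (1 / s)) 1 with hδ
  have hr0 : 0 < (D ^ s + e) ^ (1 / s) := Real.rpow_pos_of_pos (by linarith) _
  have hδ0 : 0 < δ := lt_min hr0 one_pos
  have hDδ : D ≤ δ := by
    refine le_min ?_ hD1
    calc D = (D ^ s) ^ (1 / s) := by
          rw [← Real.rpow_mul hD0, mul_one_div_cancel hs.ne', Real.rpow_one]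
      _ ≤ _ := Real.rpow_le_rpow hDs (by linarith) (by positivity)
  have hδs : δ ^ s ≤ D ^ s + e := by
    calc δ ^ s ≤ ((D ^ s + e) ^ (1 / s)) ^ s := Real.rpow_le_rpow hδ0.le (min_le_left _ _) hs.le
      _ = D ^ s + e := by
        rw [← Real.rpow_mul (by linarith), one_div_mul_cancel hs.ne', Real.rpow_one]
  obtain ⟨l, hl1, hl2⟩ := exists_nat_pow_near_of_lt_one hδ0 (min_le_right _ _)
    (inv_pos.2 hn0) (inv_lt_one_of_one_lt₀ hn1)
  refine ⟨l, hDδ.trans (by rwa [one_div, ← inv_pow]), ?_⟩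
  have e1 : ((n : ℝ) ^ (-s)) ^ l = (n : ℝ) ^ s * (((n : ℝ)⁻¹) ^ (l + 1)) ^ s := by
    have h1 : (((n : ℝ)⁻¹) ^ (l + 1)) ^ s = ((n : ℝ) ^ (-s)) ^ (l + 1) := by
      rw [← Real.rpow_natCast, ← Real.rpow_mul (by positivity), mul_comm, Real.rpow_mul
        (by positivity), Real.rpow_natCast, Real.inv_rpow hn0.le, Real.rpow_neg hn0.le]
    rw [h1, pow_succ, mul_comm (((n : ℝ) ^ (-s)) ^ l), ← mul_assoc, ← Real.rpow_add hn0]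
    simp
  rw [e1]
  refine mul_le_mul_of_nonneg_left (le_trans ?_ hδs) (by positivity)
  exact Real.rpow_le_rpow (by positivity) hl1.le hs.le

open Classical in
/-- The cost below a cell of the cutset consisting of the cells of level `l i` that meet `t i`. -/
noncomputable def coverCost {n : ℕ} (w : ℝ≥0∞) (l : ℕ → ℕ) (t : ℕ → Set Plane) (k : ℕ)
    (c : Cell n k) : ℝ≥0∞ :=
  ∑' i, ∑ v : Cell n (l i), if (t i ∩ v.square).Nonempty ∧ c.Under v then w ^ l i else 0

theorem sum_children_coverCost_le (w : ℝ≥0∞) (l : ℕ → ℕ) (t : ℕ → Set Plane) (k : ℕ)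
    (c : Cell n k) : ∑ e ∈ c.children, coverCost w l t (k + 1) e ≤ coverCost w l t k c := by
  classical
  unfold coverCost
  rw [← Summable.tsum_finsetSum fun _ _ => ENNReal.summable]
  refine ENNReal.tsum_le_tsum fun i => ?_
  rw [Finset.sum_comm]
  refine Finset.sum_le_sum fun v _ => ?_
  by_cases h : ∃ e ∈ c.children, (t i ∩ v.square).Nonempty ∧ e.Under v
  · obtain ⟨e, he, hm, hu⟩ := h
    rw [Finset.sum_eq_single_of_mem e he fun f _ hfe => if_neg fun hf => hfe (hf.2.unique hu),
      if_pos ⟨hm, hu⟩, if_pos ⟨hm, (Cell.mem_children.1 he) ▸ hu.parent⟩]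
  · push Not at h
    rw [Finset.sum_eq_zero fun e he => if_neg fun hf => h e he hf.1 hf.2]
    exact zero_le

/-- A nonzero minimal cut for the weights `n ^ (-s)` bounds the Hausdorff dimension of the limit
set from below: an efficient cover would give a cheap cutset, and a branch avoiding the cutset
converges to an uncovered point of the limit set. -/
theorem le_dimH_limitSet (hn : 2 ≤ n) {s : ℝ≥0} (hs : 0 < s) {ω : Ω} {r : Cell n 0}
    (h : minCut keep (ENNReal.ofReal ((n : ℝ) ^ (-(s : ℝ)))) 0 r ω ≠ 0) :
    (s : ℝ≥0∞) ≤ dimH (limitSet keep ω) := by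
  classical
  refine le_dimH_of_hausdorffMeasure_ne_zero fun h0 => ?_
  have hn0 : (0 : ℝ) < n := by exact_mod_cast (by omega : 0 < n)
  have hs' : (0 : ℝ) < s := by exact_mod_cast hs
  set w := ENNReal.ofReal ((n : ℝ) ^ (-(s : ℝ))) with hw
  set η := minCut keep w 0 r ω with hη
  -- A cover of total cost `δ` gives a cutset of cost at most `A * (δ + δ)`, the second `δ`
  -- accounting for covering sets of diameter zero.
  set A : ℝ≥0∞ := 16 * ENNReal.ofReal ((n : ℝ) ^ (s : ℝ)) with hA
  have hA0 : A ≠ 0 := by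
    have : 0 < (n : ℝ) ^ (s : ℝ) := by positivity
    simp [hA, this]
  have hAt : A ≠ ⊤ := by simp [hA, ENNReal.mul_eq_top]
  have hη1 : η ≤ 1 := minCut_le_one _ _ _ _
  set δ : ℝ≥0∞ := η / 4 / A with hδ
  have hδ0 : δ ≠ 0 := by
    simp only [hδ, ne_eq, ENNReal.div_eq_zero_iff, not_or]
    exact ⟨⟨h, by simp⟩, hAt⟩
  obtain ⟨ε, hε0, hεsum⟩ := ENNReal.exists_pos_sum_of_countable hδ0 ℕ
  rw [Measure.hausdorffMeasure_apply] at h0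
  have h1 := (le_iSup₂ (f := fun (r : ℝ≥0∞) (_ : 0 < r) =>
    ⨅ (t : ℕ → Set Plane) (_ : limitSet keep ω ⊆ ⋃ n, t n) (_ : ∀ n, Metric.ediam (t n) ≤ r),
      ∑' n, ⨆ _ : (t n).Nonempty, Metric.ediam (t n) ^ (s : ℝ)) 1 one_pos).trans_lt
    (h0.le.trans_lt (pos_iff_ne_zero.2 hδ0))
  simp only [iInf_lt_iff] at h1
  obtain ⟨t, hcov, hdiam, hsum⟩ := h1
  have hDtop : ∀ i, Metric.ediam (t i) ≠ ⊤ := fun i =>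
    ne_top_of_le_ne_top ENNReal.one_ne_top (hdiam i)
  have hlev := fun i => exists_level hn hs' (ENNReal.toReal_nonneg (a := Metric.ediam (t i)))
    (by simpa using ENNReal.toReal_mono ENNReal.one_ne_top (hdiam i))
    (NNReal.coe_pos.2 (hε0 i))
  choose l hl1 hl2 using hlev
  have hterm : ∀ i, (∑ v : Cell n (l i),
      if (t i ∩ v.square).Nonempty ∧ r.Under v then w ^ l i else 0) ≤
      A * ((⨆ _ : (t i).Nonempty, Metric.ediam (t i) ^ (s : ℝ)) + ε i) := by
    intro i
    rcases (t i).eq_empty_or_nonempty with hemp | hne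
    · simp [hemp]
    have hwl : w ^ l i ≤ ENNReal.ofReal ((n : ℝ) ^ (s : ℝ)) *
        (Metric.ediam (t i) ^ (s : ℝ) + ε i) := by
      have := ENNReal.ofReal_le_ofReal (hl2 i)
      rw [ENNReal.ofReal_pow (by positivity), ENNReal.ofReal_mul (by positivity),
        ENNReal.ofReal_add (by positivity) (by positivity),
        ← ENNReal.ofReal_rpow_of_nonneg ENNReal.toReal_nonneg hs'.le,
        ENNReal.ofReal_toReal (hDtop i), ENNReal.ofReal_coe_nnreal] at this
      exact this
    have hcard := card_filter_meets_le (n := n) (by omega) (l := l i) (T := t i) fun x hx y hy => by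
      refine le_trans ?_ (hl1 i)
      rw [dist_edist]
      exact ENNReal.toReal_mono (hDtop i) (Metric.edist_le_ediam_of_mem hx hy)
    calc (∑ v : Cell n (l i), if (t i ∩ v.square).Nonempty ∧ r.Under v then w ^ l i else 0)
        ≤ ∑ v : Cell n (l i), if (t i ∩ v.square).Nonempty then w ^ l i else 0 := by
          refine Finset.sum_le_sum fun v _ => ?_
          by_cases h1 : (t i ∩ v.square).Nonempty <;> by_cases h2 : r.Under v <;> simp [h1, h2]
      _ = ((Finset.univ.filter fun v : Cell n (l i) => (t i ∩ v.square).Nonempty).card : ℝ≥0∞) *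
            w ^ l i := by rw [← Finset.sum_filter, Finset.sum_const, nsmul_eq_mul]
      _ ≤ 16 * (ENNReal.ofReal ((n : ℝ) ^ (s : ℝ)) *
            (Metric.ediam (t i) ^ (s : ℝ) + ε i)) :=
          mul_le_mul' (by exact_mod_cast hcard) hwl
      _ = _ := by rw [hA, ciSup_pos hne, mul_assoc]
  have hlt : coverCost w l t 0 r < η := by
    calc coverCost w l t 0 r ≤
          ∑' i, A * ((⨆ _ : (t i).Nonempty, Metric.ediam (t i) ^ (s : ℝ)) + ε i) :=
          ENNReal.tsum_le_tsum hterm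
      _ = A * (∑' i, (⨆ _ : (t i).Nonempty, Metric.ediam (t i) ^ (s : ℝ)) + ∑' i, (ε i : ℝ≥0∞)) := by
          rw [ENNReal.tsum_mul_left, ENNReal.tsum_add]
      _ ≤ A * (δ + δ) := by gcongr
      _ = η / 4 + η / 4 := by
          rw [mul_add, hδ, ENNReal.mul_div_cancel hA0 hAt]
      _ < η := by
          lift η to ℝ≥0 using ne_top_of_le_ne_top ENNReal.one_ne_top hη1 with η'
          have h0' : 0 < η' := pos_iff_ne_zero.2 (by simpa using h)
          rw [show (η' : ℝ≥0∞) / 4 + (η' : ℝ≥0∞) / 4 = ((η' / 4 + η' / 4 : ℝ≥0) : ℝ≥0∞) by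
            rw [ENNReal.coe_add, ENNReal.coe_div (by norm_num)]; norm_num]
          rw [ENNReal.coe_lt_coe, ← NNReal.coe_lt_coe]
          push_cast
          have : (0 : ℝ) < η' := h0'
          linarith
  obtain ⟨x, hxM, hx⟩ := exists_mem_limitSet_of_lt_minCut (by omega) ENNReal.ofReal_ne_top
    (coverCost w l t) (sum_children_coverCost_le w l t) r hlt
  obtain ⟨i, hi⟩ := mem_iUnion.1 (hcov hxM)
  obtain ⟨c, hxc, hc⟩ := hx (l i)
  refine absurd hc (not_lt.2 ?_)
  calc w ^ l i = if (t i ∩ c.square).Nonempty ∧ c.Under c then w ^ l i else 0 :=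
        (if_pos ⟨⟨x, hi, hxc⟩, c.under_refl⟩).symm
    _ ≤ ∑ v : Cell n (l i), if (t i ∩ v.square).Nonempty ∧ c.Under v then w ^ l i else 0 :=
        Finset.single_le_sum (f := fun v : Cell n (l i) =>
          if (t i ∩ v.square).Nonempty ∧ c.Under v then w ^ l i else 0)
          (fun _ _ => zero_le) (Finset.mem_univ c)
    _ ≤ coverCost w l t (l i) c := ENNReal.le_tsum i

end LowerBound

/-! ### The two sides of a grid line -/

section Sides

variable {Ω : Type*} {n : ℕ} {keep : PosCell n → Set Ω}

/-- The part of the limit set lying, through surviving cells, below the hyperplane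
`x t = i / n ^ k`: a point of the hyperplane is included if it is a limit of surviving cells
below. -/
def lowerPart (keep : PosCell n → Set Ω) (ω : Ω) (t : Fin 2) (k i : ℕ) : Set Plane :=
  ⋂ d, ⋃ (c : Cell n (k + d)) (_ : Survives keep ω (k + d) c ∧ c.coord t + 1 ≤ i * n ^ d), c.square

/-- The part of the limit set lying, through surviving cells, above the hyperplane
`x t = i / n ^ k`. -/
def upperPart (keep : PosCell n → Set Ω) (ω : Ω) (t : Fin 2) (k i : ℕ) : Set Plane :=
  ⋂ d, ⋃ (c : Cell n (k + d)) (_ : Survives keep ω (k + d) c ∧ i * n ^ d ≤ c.coord t), c.square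

/-- The points of grid lines that are reached by surviving cells from both sides. -/
def twoSided (keep : PosCell n → Set Ω) (ω : Ω) : Set Plane :=
  ⋃ (t : Fin 2) (k : ℕ) (i : ℕ), lowerPart keep ω t k i ∩ upperPart keep ω t k i

theorem mem_lowerPart {ω : Ω} {t : Fin 2} {k i : ℕ} {x : Plane} :
    x ∈ lowerPart keep ω t k i ↔ ∀ d, ∃ c : Cell n (k + d),
      (Survives keep ω (k + d) c ∧ c.coord t + 1 ≤ i * n ^ d) ∧ x ∈ c.square := by
  simp only [lowerPart, mem_iInter, mem_iUnion, exists_prop]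

theorem mem_upperPart {ω : Ω} {t : Fin 2} {k i : ℕ} {x : Plane} :
    x ∈ upperPart keep ω t k i ↔ ∀ d, ∃ c : Cell n (k + d),
      (Survives keep ω (k + d) c ∧ i * n ^ d ≤ c.coord t) ∧ x ∈ c.square := by
  simp only [upperPart, mem_iInter, mem_iUnion, exists_prop]

theorem isClosed_lowerPart (ω : Ω) (t : Fin 2) (k i : ℕ) : IsClosed (lowerPart keep ω t k i) :=
  isClosed_iInter fun _ => isClosed_iUnion_of_finite fun c => isClosed_iUnion_of_finite fun _ =>
    c.isClosed_square

theorem isClosed_upperPart (ω : Ω) (t : Fin 2) (k i : ℕ) : IsClosed (upperPart keep ω t k i) :=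
  isClosed_iInter fun _ => isClosed_iUnion_of_finite fun c => isClosed_iUnion_of_finite fun _ =>
    c.isClosed_square

theorem parent_below_line {k i d : ℕ} {t : Fin 2} {c : Cell n (k + d + 1)}
    (h : c.coord t + 1 ≤ i * n ^ (d + 1)) : c.parent.coord t + 1 ≤ i * n ^ d := by
  rw [c.coord_parent]
  refine Nat.div_lt_of_lt_mul ?_
  have e : n * (i * n ^ d) = i * n ^ (d + 1) := by ring
  omega

theorem parent_above_line (hn : 0 < n) {k i d : ℕ} {t : Fin 2} {c : Cell n (k + d + 1)}
    (h : i * n ^ (d + 1) ≤ c.coord t) : i * n ^ d ≤ c.parent.coord t := by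
  rw [c.coord_parent, Nat.le_div_iff_mul_le hn]
  rwa [pow_succ, ← mul_assoc] at h

theorem exists_survives_of_mem_limitSet (hn : 0 < n) {ω : Ω} {x : Plane}
    (hx : x ∈ limitSet keep ω) (k : ℕ) :
    ∃ c : Cell n k, Survives keep ω k c ∧ x ∈ c.square := by
  simp only [limitSet, levelSet, mem_iInter, mem_iUnion, exists_prop] at hx
  obtain ⟨c, hc, hxc⟩ := hx (k + 1) (by omega)
  exact ⟨c.parent, hc.1, c.square_subset_parent hn hxc⟩

theorem limitSet_subset_lowerPart_union_upperPart (hn : 0 < n) (ω : Ω) (t : Fin 2) (k i : ℕ) :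
    limitSet keep ω ⊆ lowerPart keep ω t k i ∪ upperPart keep ω t k i := by
  intro x hx
  by_contra hcon
  rw [mem_union, not_or] at hcon
  obtain ⟨hl, hu⟩ := hcon
  -- Both families of finite unions decrease in the level, so failing both at some level means
  -- failing both at a common level, where every cell is on one of the two sides.
  have antiL : ∀ d e, d ≤ e → (∃ c : Cell n (k + e),
      (Survives keep ω (k + e) c ∧ c.coord t + 1 ≤ i * n ^ e) ∧ x ∈ c.square) →
      ∃ c : Cell n (k + d),
        (Survives keep ω (k + d) c ∧ c.coord t + 1 ≤ i * n ^ d) ∧ x ∈ c.square := by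
    intro d e hde
    induction e, hde using Nat.le_induction with
    | base => exact id
    | succ e _ ih =>
      rintro ⟨c, ⟨hc, hct⟩, hxc⟩
      exact ih ⟨c.parent, ⟨hc.1, parent_below_line hct⟩, c.square_subset_parent hn hxc⟩
  have antiU : ∀ d e, d ≤ e → (∃ c : Cell n (k + e),
      (Survives keep ω (k + e) c ∧ i * n ^ e ≤ c.coord t) ∧ x ∈ c.square) →
      ∃ c : Cell n (k + d),
        (Survives keep ω (k + d) c ∧ i * n ^ d ≤ c.coord t) ∧ x ∈ c.square := by
    intro d e hde
    induction e, hde using Nat.le_induction with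
    | base => exact id
    | succ e _ ih =>
      rintro ⟨c, ⟨hc, hct⟩, hxc⟩
      exact ih ⟨c.parent, ⟨hc.1, parent_above_line hn hct⟩, c.square_subset_parent hn hxc⟩
  rw [mem_lowerPart, not_forall] at hl
  rw [mem_upperPart, not_forall] at hu
  obtain ⟨d, hd⟩ := hl
  obtain ⟨e, he⟩ := hu
  obtain ⟨c, hc, hxc⟩ := exists_survives_of_mem_limitSet hn hx (k + max d e)
  rcases Nat.lt_or_ge (c.coord t) (i * n ^ max d e) with h | h
  · exact hd (antiL d _ (le_max_left _ _) ⟨c, ⟨hc, h⟩, hxc⟩)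
  · exact he (antiU e _ (le_max_right _ _) ⟨c, ⟨hc, h⟩, hxc⟩)

theorem frontier_preimage_compl_subset {X : Type*} [TopologicalSpace X] {A B T : Set X}
    (hA : IsClosed A) (hB : IsClosed B) (hAB : ∀ x, x ∈ A ∪ B) (hT : A ∩ B ⊆ T) :
    frontier Aᶜ ⊆ T := by
  rw [frontier_compl, frontier_eq_closure_inter_closure, hA.closure_eq]
  refine (inter_subset_inter_right A (closure_minimal (fun x hx => ?_) hB)).trans hT
  exact (hAB x).resolve_left hx

theorem frontier_inter_subset_of_subset {X : Type*} [TopologicalSpace X] {A B T : Set X}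
    (hA : frontier A ⊆ T) (hB : frontier B ⊆ T) : frontier (A ∩ B) ⊆ T :=
  (frontier_inter_subset A B).trans
    (union_subset (inter_subset_left.trans hA) (inter_subset_right.trans hB))

/-- The limit set has a basis whose members have their boundaries in the two-sided points of grid
lines: intersect complements of lower and upper parts. -/
theorem exists_basis_frontier_subset (hn : 2 ≤ n) (ω : Ω) :
    ∃ U : Set (Set (limitSet keep ω)), TopologicalSpace.IsTopologicalBasis U ∧
      ∀ u ∈ U, frontier u ⊆ (Subtype.val : limitSet keep ω → Plane) ⁻¹' twoSided keep ω := by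
  have hn0 : 0 < n := by omega
  let v : limitSet keep ω → Plane := Subtype.val
  have hv : Continuous v := continuous_subtype_val
  let A : Fin 2 → ℕ → ℕ → Set (limitSet keep ω) := fun t k i => v ⁻¹' lowerPart keep ω t k i
  let B : Fin 2 → ℕ → ℕ → Set (limitSet keep ω) := fun t k i => v ⁻¹' upperPart keep ω t k i
  have hA : ∀ t k i, IsClosed (A t k i) := fun t k i => (isClosed_lowerPart ω t k i).preimage hv
  have hB : ∀ t k i, IsClosed (B t k i) := fun t k i => (isClosed_upperPart ω t k i).preimage hv
  have hAB : ∀ t k i x, x ∈ A t k i ∪ B t k i := fun t k i x =>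
    limitSet_subset_lowerPart_union_upperPart hn0 ω t k i x.2
  have hT : ∀ t k i, A t k i ∩ B t k i ⊆ v ⁻¹' twoSided keep ω := fun t k i x hx =>
    mem_iUnion.2 ⟨t, mem_iUnion.2 ⟨k, mem_iUnion.2 ⟨i, hx⟩⟩⟩
  have hfA : ∀ t k i, frontier (A t k i)ᶜ ⊆ v ⁻¹' twoSided keep ω := fun t k i =>
    frontier_preimage_compl_subset (hA t k i) (hB t k i) (hAB t k i) (hT t k i)
  have hfB : ∀ t k i, frontier (B t k i)ᶜ ⊆ v ⁻¹' twoSided keep ω := fun t k i =>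
    frontier_preimage_compl_subset (hB t k i) (hA t k i)
      (fun x => (union_comm _ _).subset (hAB t k i x)) ((inter_comm _ _).subset.trans (hT t k i))
  let box : ℕ → (Fin 2 → ℕ) → (Fin 2 → ℕ) → Set (limitSet keep ω) := fun k i j =>
    ((A 0 k (i 0))ᶜ ∩ (B 0 k (j 0))ᶜ) ∩ ((A 1 k (i 1))ᶜ ∩ (B 1 k (j 1))ᶜ)
  have hbox : ∀ k i j x, x ∈ box k i j ↔ ∀ t, x ∉ A t k (i t) ∧ x ∉ B t k (j t) := by
    intro k i j x
    simp only [box, mem_inter_iff, mem_compl_iff, Fin.forall_fin_two]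
  refine ⟨{u | ∃ k i j, u = box k i j},
    TopologicalSpace.isTopologicalBasis_of_isOpen_of_nhds ?_ ?_, ?_⟩
  · rintro u ⟨k, i, j, rfl⟩
    exact ((hA _ _ _).isOpen_compl.inter (hB _ _ _).isOpen_compl).inter
      ((hA _ _ _).isOpen_compl.inter (hB _ _ _).isOpen_compl)
  · intro x V hxV hV
    obtain ⟨ε, hε, hball⟩ := Metric.isOpen_iff.1 hV x hxV
    have hnR : (1 : ℝ) < n := by exact_mod_cast (by omega : 1 < n)
    obtain ⟨k, hk⟩ := pow_unbounded_of_one_lt (4 / ε) hnR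
    have hnk : (0 : ℝ) < (n : ℝ) ^ k := by positivity
    have hx0 : ∀ t, 0 ≤ v x t * (n : ℝ) ^ k := by
      intro t
      obtain ⟨c, -, hc⟩ := exists_survives_of_mem_limitSet hn0 x.2 0
      have := ((Cell.mem_square c (v x)).1 hc t).1
      exact mul_nonneg (le_trans (by positivity) this) hnk.le
    have hfl : ∀ t, (⌊v x t * (n : ℝ) ^ k⌋₊ : ℝ) ≤ v x t * (n : ℝ) ^ k := fun t =>
      Nat.floor_le (hx0 t)
    have hfl' : ∀ t, v x t * (n : ℝ) ^ k < ⌊v x t * (n : ℝ) ^ k⌋₊ + 1 := fun t =>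
      Nat.lt_floor_add_one _
    -- The subtraction truncates when the point is in the first column; the line is then `x t = 0`,
    -- and no cell lies below it.
    set i : Fin 2 → ℕ := fun t => ⌊v x t * (n : ℝ) ^ k⌋₊ - 1 with hi
    set j : Fin 2 → ℕ := fun t => ⌊v x t * (n : ℝ) ^ k⌋₊ + 2 with hj
    have hlow : ∀ t i (y : Plane), y ∈ lowerPart keep ω t k i → 1 ≤ i ∧ y t * (n : ℝ) ^ k ≤ i := by
      intro t i y hy
      obtain ⟨c, ⟨-, hct⟩, hc⟩ := mem_lowerPart.1 hy 0
      rw [pow_zero, mul_one] at hct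
      have h2 : y t ≤ ((c.coord t : ℝ) + 1) / (n : ℝ) ^ k := ((Cell.mem_square c y).1 hc t).2
      rw [le_div_iff₀ hnk] at h2
      exact ⟨by omega, h2.trans (by exact_mod_cast hct)⟩
    have hupp : ∀ t i (y : Plane), y ∈ upperPart keep ω t k i → (i : ℝ) ≤ y t * (n : ℝ) ^ k := by
      intro t i y hy
      obtain ⟨c, ⟨-, hct⟩, hc⟩ := mem_upperPart.1 hy 0
      rw [pow_zero, mul_one] at hct
      have h1 : (c.coord t : ℝ) / (n : ℝ) ^ k ≤ y t := ((Cell.mem_square c y).1 hc t).1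
      rw [div_le_iff₀ hnk] at h1
      exact le_trans (by exact_mod_cast hct) h1
    refine ⟨box k i j, ⟨k, i, j, rfl⟩, (hbox _ _ _ _).2 fun t => ⟨fun h => ?_, fun h => ?_⟩,
      fun y hy => hball ?_⟩
    · obtain ⟨h1, h2⟩ := hlow t _ _ h
      have h3 : ((i t : ℕ) : ℝ) + 1 = ⌊v x t * (n : ℝ) ^ k⌋₊ := by
        have : i t + 1 = ⌊v x t * (n : ℝ) ^ k⌋₊ := by simp only [hi] at h1 ⊢; omega
        exact_mod_cast this
      have := hfl t
      linarith
    · have h1 := hupp t _ _ h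
      have := hfl' t
      simp only [hj] at h1
      push_cast at h1
      linarith
    · rw [hbox] at hy
      have hclose : ∀ t, |v y t - v x t| * (n : ℝ) ^ k ≤ 2 := by
        intro t
        have h1 := hupp t _ _ ((hAB t k (i t) y).resolve_left (hy t).1)
        have h2 := (hlow t _ _ ((hAB t k (j t) y).resolve_right (hy t).2)).2
        have h3 : (⌊v x t * (n : ℝ) ^ k⌋₊ : ℝ) ≤ (i t : ℝ) + 1 := by
          have : ⌊v x t * (n : ℝ) ^ k⌋₊ ≤ i t + 1 := by simp only [hi]; omega
          exact_mod_cast this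
        simp only [hj] at h2
        push_cast at h2
        have h4 := hfl t
        have h5 := hfl' t
        rw [← abs_of_pos hnk, ← abs_mul, sub_mul, abs_le]
        constructor <;> linarith
      have hdist : dist (v y) (v x) * (n : ℝ) ^ k ≤ 4 := by
        rw [EuclideanSpace.dist_eq, Fin.sum_univ_two]
        simp only [Real.dist_eq]
        have h0 := hclose 0
        have h1 := hclose 1
        have hsq : √(|v y 0 - v x 0| ^ 2 + |v y 1 - v x 1| ^ 2) ≤
            |v y 0 - v x 0| + |v y 1 - v x 1| := by
          refine Real.sqrt_le_iff.2 ⟨by positivity, ?_⟩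
          nlinarith [mul_nonneg (abs_nonneg (v y 0 - v x 0)) (abs_nonneg (v y 1 - v x 1))]
        have := mul_le_mul_of_nonneg_right hsq hnk.le
        linarith
      rw [div_lt_iff₀ hε] at hk
      have : dist (v y) (v x) * (n : ℝ) ^ k < ε * (n : ℝ) ^ k := by linarith
      exact lt_of_mul_lt_mul_right this hnk.le
  · rintro u ⟨k, i, j, rfl⟩
    exact frontier_inter_subset_of_subset
      (frontier_inter_subset_of_subset (hfA _ _ _) (hfB _ _ _))
      (frontier_inter_subset_of_subset (hfA _ _ _) (hfB _ _ _))

theorem topHausdorffDim_le_of_dimH_twoSided_le (hn : 2 ≤ n) {ω : Ω} {s : ℝ≥0}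
    (h : dimH (twoSided keep ω) ≤ s) :
    topHausdorffDim (limitSet keep ω) ≤ (((s : ℝ) + 1 : ℝ) : EReal) := by
  classical
  unfold topHausdorffDim
  split_ifs with hE
  · have : ((-1 : ℝ) : EReal) ≤ (((s : ℝ) + 1 : ℝ) : EReal) := by
      rw [EReal.coe_le_coe_iff]; linarith [NNReal.coe_nonneg s]
    simpa using this
  obtain ⟨U, hU, hfr⟩ := exists_basis_frontier_subset (keep := keep) hn ω
  refine sInf_le ⟨U, hU, fun u hu => ?_⟩
  have e1 : (((s : ℝ) + 1 : ℝ) : EReal) - 1 = ((s : ℝ) : EReal) := by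
    rw [← EReal.coe_one, ← EReal.coe_sub, add_sub_cancel_right]
  rw [e1]
  unfold hausdorffDim
  split_ifs with hemp
  · have : ((-1 : ℝ) : EReal) ≤ ((s : ℝ) : EReal) := by
      rw [EReal.coe_le_coe_iff]; linarith [NNReal.coe_nonneg s]
    simpa using this
  · have h1 : dimH (frontier u) ≤ s := by
      rw [← (isometry_subtype_coe (s := limitSet keep ω)).dimH_image]
      exact (dimH_mono (image_subset_iff.2 (hfr u hu))).trans h
    exact EReal.coe_ennreal_le_coe_ennreal_iff.2 h1

theorem topHausdorffDim_le_zero_of_twoSided_eq_empty (hn : 2 ≤ n) {ω : Ω}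
    (h : twoSided keep ω = ∅) : topHausdorffDim (limitSet keep ω) ≤ 0 := by
  classical
  unfold topHausdorffDim
  split_ifs with hE
  · simp
  obtain ⟨U, hU, hfr⟩ := exists_basis_frontier_subset (keep := keep) hn ω
  refine sInf_le ⟨U, hU, fun u hu => ?_⟩
  have h1 := hfr u hu
  rw [h, preimage_empty, subset_empty_iff] at h1
  rw [hausdorffDim, if_pos h1, zero_sub]

end Sides

/-! ### Counting adjacent pairs across a grid line -/

section Adjacent

variable {Ω : Type*} {n : ℕ} {keep : PosCell n → Set Ω}

open Classical in
/-- The pairs of intersecting cells of level `k + d`, diagonal neighbours included, that lie below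
and above the line `x t = i / n ^ k`. -/
noncomputable def adjacentPairs (n : ℕ) (t : Fin 2) (k i d : ℕ) :
    Finset (Cell n (k + d) × Cell n (k + d)) :=
  Finset.univ.filter fun P => P.1.coord t + 1 ≤ i * n ^ d ∧ i * n ^ d ≤ P.2.coord t ∧
    (P.1.square ∩ P.2.square).Nonempty

theorem mem_adjacentPairs {t : Fin 2} {k i d : ℕ} {P : Cell n (k + d) × Cell n (k + d)} :
    P ∈ adjacentPairs n t k i d ↔ P.1.coord t + 1 ≤ i * n ^ d ∧ i * n ^ d ≤ P.2.coord t ∧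
      (P.1.square ∩ P.2.square).Nonempty := by
  simp [adjacentPairs]

theorem Cell.coord_le_of_inter {k : ℕ} (hn : 0 < n) {c c' : Cell n k}
    (h : (c.square ∩ c'.square).Nonempty) (t : Fin 2) : c'.coord t ≤ c.coord t + 1 := by
  obtain ⟨x, hx, hx'⟩ := h
  have h1 := ((Cell.mem_square c x).1 hx t).2
  have h2 := ((Cell.mem_square c' x).1 hx' t).1
  have hnk : (0 : ℝ) < (n : ℝ) ^ k := by positivity
  have h3 := (div_le_div_iff_of_pos_right hnk).1 (h2.trans h1)
  exact_mod_cast h3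

theorem card_adjacentPairs_le (hn : 0 < n) (t : Fin 2) (k i d : ℕ) :
    (adjacentPairs n t k i d).card ≤ 3 * n ^ (k + d) := by
  have key : (adjacentPairs n t k i d).card ≤
      (Finset.range (n ^ (k + d)) ×ˢ Finset.range 3).card := by
    refine Finset.card_le_card_of_injOn
      (fun P => (P.1.coord (t + 1), P.2.coord (t + 1) + 1 - P.1.coord (t + 1))) ?_ ?_
    · intro P hP
      obtain ⟨-, -, h⟩ := mem_adjacentPairs.1 hP
      have h1 := Cell.coord_le_of_inter hn h (t + 1)
      have h2 := P.1.coord_lt (t + 1)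
      simp only [Finset.coe_product, Finset.coe_range, mem_prod, mem_Iio]
      exact ⟨h2, by omega⟩
    · intro P hP Q hQ hPQ
      obtain ⟨p1, p2, p3⟩ := mem_adjacentPairs.1 hP
      obtain ⟨q1, q2, q3⟩ := mem_adjacentPairs.1 hQ
      have hcov : ∀ u : Fin 2, u = t ∨ u = t + 1 := by
        intro u; fin_cases u <;> fin_cases t <;> simp
      have a1 := Cell.coord_le_of_inter hn p3 t
      have a2 := Cell.coord_le_of_inter hn q3 t
      have a3 : P.1.coord (t + 1) ≤ P.2.coord (t + 1) + 1 :=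
        Cell.coord_le_of_inter hn (by rwa [inter_comm]) (t + 1)
      have a4 : Q.1.coord (t + 1) ≤ Q.2.coord (t + 1) + 1 :=
        Cell.coord_le_of_inter hn (by rwa [inter_comm]) (t + 1)
      simp only [Prod.mk.injEq] at hPQ
      refine Prod.ext (Cell.ext_coord fun u => ?_) (Cell.ext_coord fun u => ?_)
      · rcases hcov u with rfl | rfl
        · omega
        · exact hPQ.1
      · rcases hcov u with rfl | rfl <;> omega
  refine key.trans (le_of_eq ?_)
  rw [Finset.card_product, Finset.card_range, Finset.card_range, mul_comm]

/-- The ancestors of level greater than `k` of two cells on different sides of the line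
`x t = i / n ^ k` are all different, and all of them are kept if both cells survive. -/
theorem exists_finset_keep (hn : 0 < n) (keep : PosCell n → Set Ω) (t : Fin 2) (k i d : ℕ)
    (c c' : Cell n (k + d)) (hc : c.coord t + 1 ≤ i * n ^ d) (hc' : i * n ^ d ≤ c'.coord t) :
    ∃ S : Finset (PosCell n), S.card = 2 * d ∧ (∀ v ∈ S, v.1 < k + d) ∧
      ∀ ω, Survives keep ω (k + d) c → Survives keep ω (k + d) c' → ∀ v ∈ S, ω ∈ keep v := by
  classical
  induction d with
  | zero => exact ⟨∅, by simp⟩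
  | succ d ih =>
    obtain ⟨S, hcard, hlev, hS⟩ := ih c.parent c'.parent (parent_below_line hc)
      (parent_above_line hn hc')
    have hne : (⟨k + d, c⟩ : PosCell n) ≠ ⟨k + d, c'⟩ := by
      intro h
      have : c = c' := by simpa using h
      subst this
      omega
    have h1 : (⟨k + d, c'⟩ : PosCell n) ∉ S := fun h => lt_irrefl _ (hlev _ h)
    have h2 : (⟨k + d, c⟩ : PosCell n) ∉ insert ⟨k + d, c'⟩ S := by
      rw [Finset.mem_insert, not_or]
      exact ⟨hne, fun h => lt_irrefl _ (hlev _ h)⟩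
    refine ⟨insert ⟨k + d, c⟩ (insert ⟨k + d, c'⟩ S), ?_, ?_, ?_⟩
    · rw [Finset.card_insert_of_notMem h2, Finset.card_insert_of_notMem h1, hcard]; ring
    · intro v hv
      simp only [Finset.mem_insert] at hv
      rcases hv with rfl | rfl | hv
      · exact Nat.lt_succ_self _
      · exact Nat.lt_succ_self _
      · exact (hlev v hv).trans (Nat.lt_succ_self _)
    · intro ω hω hω' v hv
      simp only [Finset.mem_insert] at hv
      rcases hv with rfl | rfl | hv
      · exact hω.2
      · exact hω'.2
      · exact hS ω hω.1 hω'.1 v hv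

/-- A two-sided point is covered, at each level, by an adjacent pair of surviving cells. -/
theorem exists_adjacentPair {ω : Ω} {t : Fin 2} {k i : ℕ} {x : Plane}
    (hx : x ∈ lowerPart keep ω t k i ∩ upperPart keep ω t k i) (d : ℕ) :
    ∃ P ∈ adjacentPairs n t k i d, (Survives keep ω (k + d) P.1 ∧ Survives keep ω (k + d) P.2) ∧
      x ∈ P.1.square := by
  obtain ⟨c, ⟨hc, hct⟩, hxc⟩ := mem_lowerPart.1 hx.1 d
  obtain ⟨c', ⟨hc', hct'⟩, hxc'⟩ := mem_upperPart.1 hx.2 d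
  exact ⟨(c, c'), mem_adjacentPairs.2 ⟨hct, hct', x, hxc, hxc'⟩, ⟨hc, hc'⟩, hxc⟩

theorem Cell.ediam_square_le (hn : 0 < n) {k : ℕ} (c : Cell n k) :
    Metric.ediam c.square ≤ ENNReal.ofReal (2 / (n : ℝ) ^ k) := by
  have hnk : (0 : ℝ) < (n : ℝ) ^ k := by positivity
  refine Metric.ediam_le fun x hx y hy => ?_
  rw [edist_dist]
  refine ENNReal.ofReal_le_ofReal ?_
  have h : ∀ t, |x t - y t| ≤ 1 / (n : ℝ) ^ k := by
    intro t
    have h1 := (Cell.mem_square c x).1 hx t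
    have h2 := (Cell.mem_square c y).1 hy t
    rw [add_div] at h1 h2
    rw [abs_le]; constructor <;> linarith [h1.1, h1.2, h2.1, h2.2]
  rw [EuclideanSpace.dist_eq, Fin.sum_univ_two]
  simp only [Real.dist_eq]
  refine Real.sqrt_le_iff.2 ⟨by positivity, ?_⟩
  have h0 := pow_le_pow_left₀ (abs_nonneg _) (h 0) 2
  have h1 := pow_le_pow_left₀ (abs_nonneg _) (h 1) 2
  have e : (2 / (n : ℝ) ^ k) ^ 2 = 4 * (1 / (n : ℝ) ^ k) ^ 2 := by ring
  rw [e]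
  nlinarith [sq_nonneg (1 / (n : ℝ) ^ k)]

variable [mΩ : MeasurableSpace Ω] {μ : Measure Ω} {p : ℝ}

theorem IsPercolation.measurableSet_survives (hk : IsPercolation μ n p keep) (k : ℕ)
    (c : Cell n k) : MeasurableSet {ω | Survives keep ω k c} := by
  induction k with
  | zero => exact MeasurableSet.univ
  | succ k ih => exact (ih c.parent).inter (hk.measurableSet_keep _)

theorem IsPercolation.measure_survives_pair_le (hk : IsPercolation μ n p keep) (hn : 0 < n)
    {t : Fin 2} {k i d : ℕ} {P : Cell n (k + d) × Cell n (k + d)}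
    (hP : P ∈ adjacentPairs n t k i d) :
    μ {ω | Survives keep ω (k + d) P.1 ∧ Survives keep ω (k + d) P.2} ≤
      ENNReal.ofReal p ^ (2 * d) := by
  obtain ⟨h1, h2, -⟩ := mem_adjacentPairs.1 hP
  obtain ⟨S, hcard, -, hS⟩ := exists_finset_keep hn keep t k i d P.1 P.2 h1 h2
  calc μ {ω | Survives keep ω (k + d) P.1 ∧ Survives keep ω (k + d) P.2}
      ≤ μ (⋂ v ∈ S, keep v) :=
        measure_mono fun ω hω => mem_iInter₂.2 fun v hv => hS ω hω.1 hω.2 v hv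
    _ = ENNReal.ofReal p ^ (2 * d) := by
        rw [hk.indep.meas_biInter, Finset.prod_congr rfl fun v _ => hk.prob v, Finset.prod_const,
          hcard]

theorem IsPercolation.sum_measure_pair_le (hk : IsPercolation μ n p keep) (hn : 0 < n)
    (hp : 0 ≤ p) (t : Fin 2) (k i d : ℕ) :
    ∑ P ∈ adjacentPairs n t k i d,
      μ {ω | Survives keep ω (k + d) P.1 ∧ Survives keep ω (k + d) P.2} ≤
      ENNReal.ofReal (3 * (n : ℝ) ^ (k + d) * p ^ (2 * d)) := by
  refine (Finset.sum_le_sum fun P hP => hk.measure_survives_pair_le hn hP).trans ?_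
  rw [Finset.sum_const, nsmul_eq_mul, ENNReal.ofReal_mul (by positivity), ENNReal.ofReal_pow hp]
  gcongr
  rw [← ENNReal.ofReal_natCast]
  refine ENNReal.ofReal_le_ofReal ?_
  exact_mod_cast card_adjacentPairs_le hn t k i d

/-- In the subcritical case `n * p ^ 2 < 1` no line is reached from both sides. -/
theorem IsPercolation.ae_twoSided_eq_empty (hk : IsPercolation μ n p keep) (hn : 0 < n)
    (hp : 0 ≤ p) (hnp : n * p ^ 2 < 1) : ∀ᵐ ω ∂μ, twoSided keep ω = ∅ := by
  simp only [twoSided, iUnion_eq_empty]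
  refine ae_all_iff.2 fun t => ae_all_iff.2 fun k => ae_all_iff.2 fun i => ?_
  rw [ae_iff]
  have hle : ∀ d, μ {ω | ¬lowerPart keep ω t k i ∩ upperPart keep ω t k i = ∅} ≤
      ENNReal.ofReal (3 * (n : ℝ) ^ k * (n * p ^ 2) ^ d) := by
    intro d
    calc μ {ω | ¬lowerPart keep ω t k i ∩ upperPart keep ω t k i = ∅}
        ≤ μ (⋃ P ∈ adjacentPairs n t k i d,
            {ω | Survives keep ω (k + d) P.1 ∧ Survives keep ω (k + d) P.2}) := by
          refine measure_mono fun ω hω => ?_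
          obtain ⟨x, hx⟩ := nonempty_iff_ne_empty.2 hω
          obtain ⟨P, hP, hs, -⟩ := exists_adjacentPair hx d
          exact mem_iUnion₂.2 ⟨P, hP, hs⟩
      _ ≤ _ := (measure_biUnion_finset_le _ _).trans (hk.sum_measure_pair_le hn hp t k i d)
      _ = _ := by congr 1; rw [pow_add, mul_pow, ← pow_mul]; ring
  have hlim : Tendsto (fun d : ℕ => ENNReal.ofReal (3 * (n : ℝ) ^ k * (n * p ^ 2) ^ d)) atTop
      (𝓝 0) := by
    rw [← ENNReal.ofReal_zero, ← mul_zero (3 * (n : ℝ) ^ k)]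
    exact ENNReal.tendsto_ofReal
      ((tendsto_pow_atTop_nhds_zero_of_lt_one (by positivity) hnp).const_mul _)
  exact nonpos_iff_eq_zero.1 (ge_of_tendsto' hlim hle)

/-- When `n ^ s = n * p ^ 2`, the expected `s`-dimensional cost of covering the two-sided points
of a line by adjacent pairs stays bounded, so by Fatou's lemma the `s`-dimensional Hausdorff
measure is almost surely finite. -/
theorem IsPercolation.ae_dimH_twoSided_le (hk : IsPercolation μ n p keep) (hn : 2 ≤ n)
    (hp : 0 < p) {s : ℝ≥0} (hs : (n : ℝ) ^ (s : ℝ) = n * p ^ 2) :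
    ∀ᵐ ω ∂μ, dimH (twoSided keep ω) ≤ s := by
  classical
  have hn0 : (0 : ℝ) < n := by exact_mod_cast (by omega : 0 < n)
  have hnN : 0 < n := by omega
  have main : ∀ (t : Fin 2) (k i : ℕ), ∀ᵐ ω ∂μ,
      dimH (lowerPart keep ω t k i ∩ upperPart keep ω t k i) ≤ s := by
    intro t k i
    set E : ∀ d, Cell n (k + d) × Cell n (k + d) → Set Ω := fun d P =>
      {ω | Survives keep ω (k + d) P.1 ∧ Survives keep ω (k + d) P.2} with hE
    have hEm : ∀ d P, MeasurableSet (E d P) := fun d P =>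
      (hk.measurableSet_survives _ P.1).inter (hk.measurableSet_survives _ P.2)
    set b : ℕ → ℝ≥0∞ := fun d => ENNReal.ofReal ((2 / (n : ℝ) ^ (k + d)) ^ (s : ℝ)) with hb
    set f : ℕ → Ω → ℝ≥0∞ := fun d ω =>
      (∑ P ∈ adjacentPairs n t k i d, (E d P).indicator 1 ω) * b d with hf
    have hfm : ∀ d, Measurable (f d) := fun d =>
      (Finset.measurable_sum _ fun P _ => measurable_one.indicator (hEm d P)).mul_const _
    set A : ℝ≥0∞ := ENNReal.ofReal (3 * (2 : ℝ) ^ (s : ℝ) * (p ^ (2 * k))⁻¹) with hA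
    have hint : ∀ d, ∫⁻ ω, f d ω ∂μ ≤ A := by
      intro d
      simp only [hf]
      rw [lintegral_mul_const _ (Finset.measurable_sum _ fun P _ =>
          measurable_one.indicator (hEm d P)),
        lintegral_finsetSum _ fun P _ => measurable_one.indicator (hEm d P)]
      simp_rw [fun P => lintegral_indicator_one (μ := μ) (hEm d P)]
      refine (mul_le_mul_left (hk.sum_measure_pair_le hnN hp.le t k i d) _).trans ?_
      rw [hb, ← ENNReal.ofReal_mul (by positivity)]
      refine ENNReal.ofReal_le_ofReal (le_of_eq ?_)
      have e1 : ((n : ℝ) ^ (k + d)) ^ (s : ℝ) = (n * p ^ 2) ^ (k + d) := by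
        rw [← hs, ← Real.rpow_natCast, ← Real.rpow_mul hn0.le, mul_comm, Real.rpow_mul hn0.le,
          Real.rpow_natCast]
      rw [Real.div_rpow (by norm_num) (by positivity), e1]
      field_simp
      ring
    have hfin : ∀ᵐ ω ∂μ, liminf (fun d => f d ω) atTop < ⊤ := by
      refine ae_lt_top (Measurable.liminf hfm) (ne_top_of_le_ne_top ENNReal.ofReal_ne_top
        (?_ : _ ≤ A))
      refine (lintegral_liminf_le hfm).trans ?_
      exact liminf_le_of_le (by isBoundedDefault) fun b hb => by
        obtain ⟨d, hd⟩ := hb.exists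
        exact hd.trans (hint d)
    filter_upwards [hfin] with ω hω
    refine dimH_le_of_hausdorffMeasure_ne_top (ne_top_of_le_ne_top hω.ne ?_)
    have hr : Tendsto (fun d : ℕ => ENNReal.ofReal (2 / (n : ℝ) ^ (k + d))) atTop (𝓝 0) := by
      rw [← ENNReal.ofReal_zero]
      refine ENNReal.tendsto_ofReal ?_
      have h1 : Tendsto (fun d : ℕ => (n : ℝ) ^ (d + k)) atTop atTop :=
        (tendsto_add_atTop_iff_nat k).2
          (tendsto_pow_atTop_atTop_of_one_lt (by exact_mod_cast (by omega : 1 < n)))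
      simp_rw [add_comm k]
      exact h1.const_div_atTop 2
    have := Measure.hausdorffMeasure_le_liminf_sum (s : ℝ)
      (lowerPart keep ω t k i ∩ upperPart keep ω t k i) (l := atTop)
      (ι := fun d => {P : Cell n (k + d) × Cell n (k + d) //
        P ∈ (adjacentPairs n t k i d).filter fun P => ω ∈ E d P}) _ hr
      (fun d P => P.1.1.square)
      (Eventually.of_forall fun d P => Cell.ediam_square_le hnN _)
      (Eventually.of_forall fun d x hx => by
        obtain ⟨P, hP, hs, hxP⟩ := exists_adjacentPair hx d
        exact mem_iUnion.2 ⟨⟨P, Finset.mem_filter.2 ⟨hP, hs⟩⟩, hxP⟩)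
    refine this.trans (liminf_le_liminf (Eventually.of_forall fun d => ?_))
    simp only [hf]
    have e2 : (∑ P ∈ adjacentPairs n t k i d, (E d P).indicator (1 : Ω → ℝ≥0∞) ω) =
        ((adjacentPairs n t k i d).filter fun P => ω ∈ E d P).card := by
      rw [Finset.card_filter, Nat.cast_sum]
      refine Finset.sum_congr rfl fun P _ => ?_
      by_cases h : ω ∈ E d P <;> simp [h]
    rw [e2]
    refine (Finset.sum_le_card_nsmul _ _ (b d) fun P _ => ?_).trans (le_of_eq ?_)
    · simp only [hb]
      rw [← ENNReal.ofReal_rpow_of_nonneg (by positivity) s.coe_nonneg]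
      exact ENNReal.rpow_le_rpow (Cell.ediam_square_le hnN _) s.coe_nonneg
    · simp [nsmul_eq_mul]
  have main' : ∀ᵐ ω ∂μ, ∀ t k i,
      dimH (lowerPart keep ω t k i ∩ upperPart keep ω t k i) ≤ s :=
    ae_all_iff.2 fun t => ae_all_iff.2 fun k => ae_all_iff.2 fun i => main t k i
  filter_upwards [main'] with ω hω
  simp only [twoSided, dimH_iUnion, iSup_le_iff]
  exact hω

end Adjacent

/-! ### The dimension estimates for the limit set -/

section Conclusion

variable {Ω : Type*} [MeasurableSpace Ω] {μ : Measure Ω} {n : ℕ} {p : ℝ}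
  {keep : PosCell n → Set Ω}

theorem rpow_log_div_log {n : ℕ} {p : ℝ} (hn : 2 ≤ n) (hp0 : 0 < p) :
    (n : ℝ) ^ (Real.log p / Real.log n) = p := by
  have hn1 : (1 : ℝ) < n := by exact_mod_cast (by omega : 1 < n)
  rw [Real.rpow_def_of_pos (by linarith), mul_div_cancel₀ _ (Real.log_pos hn1).ne',
    Real.exp_log hp0]

theorem rpow_one_add_two_mul_log_div_log {n : ℕ} {p : ℝ} (hn : 2 ≤ n) (hp0 : 0 < p) :
    (n : ℝ) ^ (1 + 2 * (Real.log p / Real.log n)) = n * p ^ 2 := by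
  have hn0 : (0 : ℝ) < n := by exact_mod_cast (by omega : 0 < n)
  rw [Real.rpow_add hn0, Real.rpow_one, mul_comm (2 : ℝ), Real.rpow_mul hn0.le,
    rpow_log_div_log hn hp0, Real.rpow_two]

theorem rpow_two_add_log_div_log {n : ℕ} {p : ℝ} (hn : 2 ≤ n) (hp0 : 0 < p) :
    (n : ℝ) ^ (2 + Real.log p / Real.log n) = n ^ 2 * p := by
  have hn0 : (0 : ℝ) < n := by exact_mod_cast (by omega : 0 < n)
  rw [Real.rpow_add hn0, Real.rpow_two, rpow_log_div_log hn hp0]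

theorem IsPercolation.ae_topHausdorffDim_le (hk : IsPercolation μ n p keep) (hn : 2 ≤ n)
    (hp0 : 0 < p) (hnp : 1 ≤ n * p ^ 2) :
    ∀ᵐ ω ∂μ, topHausdorffDim (limitSet keep ω) ≤
      ((2 + 2 * (Real.log p / Real.log n) : ℝ) : EReal) := by
  have hn1 : (1 : ℝ) < n := by exact_mod_cast (by omega : 1 < n)
  have hs0 : 0 ≤ 1 + 2 * (Real.log p / Real.log n) := by
    rw [← rpow_one_add_two_mul_log_div_log hn hp0] at hnp
    by_contra! h
    exact absurd (Real.rpow_lt_one_of_one_lt_of_neg hn1 h) (not_lt.2 hnp)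
  filter_upwards [hk.ae_dimH_twoSided_le hn hp0 (s := ⟨_, hs0⟩)
    (rpow_one_add_two_mul_log_div_log hn hp0)] with ω hω
  refine (topHausdorffDim_le_of_dimH_twoSided_le hn hω).trans
    (EReal.coe_le_coe_iff.2 (le_of_eq ?_))
  change 1 + 2 * (Real.log p / Real.log n) + 1 = _
  ring

variable [IsProbabilityMeasure μ]

/-- Up to a null set, the limit set is empty or has dimension at least `s`, for each `s` below
`2 + log p / log n`. -/
theorem IsPercolation.ae_le_hausdorffDim (hk : IsPercolation μ n p keep) (hn : 2 ≤ n)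
    (hp0 : 0 < p) (hp1 : p < 1) {s : ℝ} (hs : 0 < s) (hsp : (n : ℝ) ^ s < n ^ 2 * p) :
    ∀ᵐ ω ∂μ, ((s : ℝ) : EReal) ≤ hausdorffDim (limitSet keep ω) ∨ limitSet keep ω = ∅ := by
  have hn0 : (0 : ℝ) < n := by exact_mod_cast (by omega : 0 < n)
  obtain ⟨ε, hε0, hε⟩ := hk.exists_le_lintegral_capFlow hn hs hsp
  have hw0 : ENNReal.ofReal ((n : ℝ) ^ (-s)) ≠ 0 := by
    have : 0 < (n : ℝ) ^ (-s) := Real.rpow_pos_of_pos hn0 _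
    simpa using this
  let r : Cell n 0 := (⟨0, by simp⟩, ⟨0, by simp⟩)
  filter_upwards [hk.ae_extinct_of_minCut_eq_zero hn hp0 hp1 ENNReal.ofReal_ne_top hw0 hε0 hε r]
    with ω hω
  by_cases hE : limitSet keep ω = ∅
  · exact Or.inr hE
  left
  lift s to ℝ≥0 using hs.le
  have h1 := le_dimH_limitSet (keep := keep) hn (by exact_mod_cast hs)
    fun h => hE (limitSet_eq_empty hw0 (hω h))
  rw [hausdorffDim, if_neg hE]
  exact EReal.coe_ennreal_le_coe_ennreal_iff.2 h1

theorem IsPercolation.ae_topHausdorffDim_lt (hk : IsPercolation μ n p keep) (hn : 2 ≤ n)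
    (hp0 : 0 < p) (hp1 : p < 1) :
    ∀ᵐ ω ∂μ, topHausdorffDim (limitSet keep ω) < hausdorffDim (limitSet keep ω) ∨
      limitSet keep ω = ∅ := by
  have hn0 : (0 : ℝ) < n := by exact_mod_cast (by omega : 0 < n)
  have hn1 : (1 : ℝ) < n := by exact_mod_cast (by omega : 1 < n)
  set L := Real.log p / Real.log n with hL
  have hL0 : L < 0 := div_neg_of_neg_of_pos (Real.log_neg hp0 hp1) (Real.log_pos hn1)
  -- Any value `s` strictly between the upper bound `u` for the topological Hausdorff dimension
  -- and the dimension `2 + L` of the limit set separates the two.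
  have sep : ∀ u : ℝ, 0 ≤ u → u < 2 + L →
      (∀ᵐ ω ∂μ, topHausdorffDim (limitSet keep ω) ≤ (u : EReal)) →
      ∀ᵐ ω ∂μ, topHausdorffDim (limitSet keep ω) < hausdorffDim (limitSet keep ω) ∨
        limitSet keep ω = ∅ := by
    intro u hu0 hu h
    obtain ⟨s, hus, hs⟩ := exists_between hu
    have hsp : (n : ℝ) ^ s < n ^ 2 * p := by
      rw [← rpow_two_add_log_div_log hn hp0]
      exact Real.rpow_lt_rpow_of_exponent_lt hn1 hs
    filter_upwards [h, hk.ae_le_hausdorffDim hn hp0 hp1 (hu0.trans_lt hus) hsp] with ω h1 h2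
    exact h2.imp_left fun h2 => (h1.trans_lt (EReal.coe_lt_coe_iff.2 hus)).trans_le h2
  rcases le_or_gt 1 ((n : ℝ) * p ^ 2) with hnp | hnp
  · refine sep (2 + 2 * L) ?_ (by linarith) (hk.ae_topHausdorffDim_le hn hp0 hnp)
    rw [← rpow_one_add_two_mul_log_div_log hn hp0] at hnp
    by_contra! h
    exact absurd (Real.rpow_lt_one_of_one_lt_of_neg hn1 (by rw [← hL]; linarith)) (not_lt.2 hnp)
  rcases le_or_gt ((n : ℝ) ^ 2 * p) 1 with hm | hm
  · let r : Cell n 0 := (⟨0, by simp⟩, ⟨0, by simp⟩)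
    filter_upwards [hk.ae_extinct_of_le_one hn hp0 hp1 hm r] with ω hω
    exact Or.inr (limitSet_eq_empty one_ne_zero hω)
  · refine sep 0 le_rfl ?_ ?_
    · rw [← rpow_two_add_log_div_log hn hp0] at hm
      by_contra! h
      exact absurd (Real.rpow_le_one_of_one_le_of_nonpos hn1.le h) (not_le.2 hm)
    · filter_upwards [hk.ae_twoSided_eq_empty (by omega) hp0.le hnp] with ω hω
      exact topHausdorffDim_le_zero_of_twoSided_eq_empty hn hω

end Conclusion

end FractalPercolation

theorem corollaryc {Ω : Type*} [MeasurableSpace Ω] (μ : Measure Ω) [IsProbabilityMeasure μ]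
    (n : ℕ) (hn : 2 ≤ n) (p : ℝ) (hp0 : 0 < p) (hp1 : p < 1)
    (keep : FractalPercolation.PosCell n → Set Ω)
    (hkeep : FractalPercolation.IsPercolation μ n p keep) :
    (1 / Real.sqrt n < p →
      ∀ᵐ ω ∂μ, FractalPercolation.topHausdorffDim (FractalPercolation.limitSet keep ω) ≤
        ((2 + 2 * (Real.log p / Real.log n) : ℝ) : EReal)) ∧
    (∀ᵐ ω ∂μ,
      FractalPercolation.topHausdorffDim (FractalPercolation.limitSet keep ω) <
          FractalPercolation.hausdorffDim (FractalPercolation.limitSet keep ω) ∨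
        FractalPercolation.limitSet keep ω = ∅) := by
  refine ⟨fun h => hkeep.ae_topHausdorffDim_le hn hp0 ?_, hkeep.ae_topHausdorffDim_lt hn hp0 hp1⟩
  have hn0 : (0 : ℝ) < n := by exact_mod_cast (by omega : 0 < n)
  have h1 := (div_lt_iff₀ (Real.sqrt_pos.2 hn0)).1 h
  calc (1 : ℝ) ≤ (p * √n) ^ 2 := one_le_pow₀ h1.le
    _ = n * p ^ 2 := by rw [mul_pow, Real.sq_sqrt hn0.le, mul_comm]
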